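/- Consider a stochastic $K$-armed bandit with reward distributions $P_1,\dots,P_K$ supported in $[0,1]$ with means $\mu_1,\dots,\mu_K$, and gaps $\Delta_i=\max_j\mu_j-\mu_i$; the reward $Y_{i,t}$ of arm $i$ in round $t$ is drawn from $P_i$, independently over arms and rounds. Perturbed-history exploration (PHE) with integer perturbation scale $a$ works as follows. In each round $t=1,2,\dots$, let $s=T_{i,t-1}$ be the number of earlier pulls of arm $i$ and $V_{i,s}$ the sum of the rewards obtained in these pulls. If $s>0$, PHE draws fresh i.i.d. pseudo-rewards $Z_1,\dots,Z_{as}\sim\mathrm{Ber}(1/2)$, independent over arms and rounds and independent of the rewards, and sets $$\hat\mu_{i,t}=\frac{V_{i,s}+\sum_{\ell=1}^{as}Z_\ell}{(a+1)s};$$ if $s=0$, it sets $\hat\mu_{i,t}=+\infty$. It then pulls an arm $I_t\in\arg\max_i\hat\mu_{i,t}$, where ties are broken by any (possibly randomized) rule that does not depend on the current or future rewards or on future pseudo-rewards, and observes $Y_{I_t,t}$. Let $$R(n)=\sum_{i=1}^K\Delta_i\,\mathbb E\Big[\sum_{t=1}^n\mathbf 1\{I_t=i\}\Big]$$ be the expected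 $n$-round regret. Then for every integer $a>2$, every such bandit and every $n$, $$R(n)\le 4\sqrt{2a(2c+1)\,K\,n\log n}+5K,\qquad c=\frac{e^2\sqrt{2a}}{\sqrt\pi}\exp\Big[\frac{16}{a-2}\Big]\Big(1+\sqrt{\frac{\pi a}{8(a-2)}}\Big).$$ -/

import Mathlib

open MeasureTheory ProbabilityTheory

noncomputable section

namespace PHE

/-- A stochastic `K`-armed bandit with rewards in `[0, 1]`: the reward distribution of every arm
is a probability measure on `ℝ` concentrated on `[0, 1]`. -/
structure Bandit (K : ℕ) where
  law : Fin K → Measure ℝ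
  isProb : ∀ i, IsProbabilityMeasure (law i)
  support : ∀ i, law i (Set.Icc (0 : ℝ) 1)ᶜ = 0

/-- The mean reward of arm `i`. -/
def Bandit.mean {K : ℕ} (B : Bandit K) (i : Fin K) : ℝ := ∫ x, x ∂(B.law i)

/-- The gap of arm `i`: the largest mean reward minus the mean reward of arm `i`. -/
def Bandit.gap {K : ℕ} (B : Bandit K) (i : Fin K) : ℝ := (⨆ j, B.mean j) - B.mean i

/-- The Bernoulli distribution `Ber(1/2)` on `{0, 1} ⊆ ℝ`. -/
def fairCoin : Measure ℝ := bernoulliMeasure (1 : ℝ) 0 ⟨1 / 2, by norm_num, by norm_num⟩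

section Algorithm

/- Rounds are numbered `0, 1, 2, …`. In round `t`,
`I t` is the pulled arm, `Y i t` is the reward of arm `i` (observed if arm `i` is pulled), and
`Z i t ℓ`, `ℓ = 0, 1, 2, …`, is the supply of fresh pseudo-rewards for arm `i`. -/

variable {K : ℕ} {Ω E : Type*}

/-- The number of pulls of arm `i` in the first `t` rounds. -/
def pulls (I : ℕ → Ω → Fin K) (i : Fin K) (t : ℕ) (ω : Ω) : ℕ :=
  ∑ r ∈ Finset.range t, if I r ω = i then 1 else 0

/-- The cumulative reward of arm `i` collected in the first `t` rounds. -/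
def cumReward (I : ℕ → Ω → Fin K) (Y : Fin K → ℕ → Ω → ℝ) (i : Fin K) (t : ℕ) (ω : Ω) : ℝ :=
  ∑ r ∈ Finset.range t, if I r ω = i then Y i r ω else 0

/-- The estimated reward of arm `i` in round `t` with perturbation scale `a`. If arm `i` has been
pulled `s > 0` times before, it is the average of its `s` observed rewards and `a * s` fresh
pseudo-rewards; if it has never been pulled, it is `+∞`. -/
def estimate (a : ℕ) (I : ℕ → Ω → Fin K) (Y : Fin K → ℕ → Ω → ℝ) (Z : Fin K → ℕ → ℕ → Ω → ℝ)
    (i : Fin K) (t : ℕ) (ω : Ω) : EReal :=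
  if 0 < pulls I i t ω then
    (((cumReward I Y i t ω + ∑ l ∈ Finset.range (a * pulls I i t ω), Z i t l ω) /
      (((a : ℝ) + 1) * (pulls I i t ω : ℝ)) : ℝ) : EReal)
  else ⊤

/-- The independent sources of randomness, as σ-algebras: the seed `ξ` (which may be used for
randomized tie-breaking), each reward and each pseudo-reward. -/
@[reducible] def sources [MeasurableSpace E] (ξ : Ω → E) (Y : Fin K → ℕ → Ω → ℝ) (Z : Fin K → ℕ → ℕ → Ω → ℝ) :
    Unit ⊕ (Fin K × ℕ) ⊕ (Fin K × ℕ × ℕ) → MeasurableSpace Ω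
  | .inl _ => MeasurableSpace.comap ξ inferInstance
  | .inr (.inl p) => MeasurableSpace.comap (Y p.1 p.2) inferInstance
  | .inr (.inr q) => MeasurableSpace.comap (Z q.1 q.2.1 q.2.2) inferInstance

/-- What may influence the choice of the arm in round `t`: the seed, the rewards of the earlier
rounds, and the pseudo-rewards of the rounds up to and including `t`. -/
@[reducible] def info [MeasurableSpace E] (ξ : Ω → E) (Y : Fin K → ℕ → Ω → ℝ) (Z : Fin K → ℕ → ℕ → Ω → ℝ)
    (t : ℕ) : MeasurableSpace Ω :=
  MeasurableSpace.comap ξ inferInstance ⊔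
    (⨆ (i : Fin K) (r : ℕ) (_ : r < t), MeasurableSpace.comap (Y i r) inferInstance) ⊔
    (⨆ (i : Fin K) (r : ℕ) (_ : r ≤ t) (l : ℕ), MeasurableSpace.comap (Z i r l) inferInstance)

/-- `I` is the sequence of arms pulled by perturbed-history exploration with integer perturbation
scale `a` in the bandit `B`, run on the probability space `(Ω, P)`. Ties in the maximization may be
broken by any non-anticipating rule, possibly randomized through the seed `ξ`. -/
structure IsRun [MeasurableSpace Ω] [MeasurableSpace E] (P : Measure Ω) (B : Bandit K) (a : ℕ)
    (ξ : Ω → E) (Y : Fin K → ℕ → Ω → ℝ) (Z : Fin K → ℕ → ℕ → Ω → ℝ)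
    (I : ℕ → Ω → Fin K) : Prop where
  measurable_seed : Measurable ξ
  measurable_reward : ∀ i t, Measurable (Y i t)
  measurable_pseudo : ∀ i t l, Measurable (Z i t l)
  reward_law : ∀ i t, P.map (Y i t) = B.law i
  pseudo_law : ∀ i t l, P.map (Z i t l) = fairCoin
  indep : iIndep (sources ξ Y Z) P
  nonanticipating : ∀ t, Measurable[info ξ Y Z t] (I t)
  pulls_argmax : ∀ t ω j, estimate a I Y Z j t ω ≤ estimate a I Y Z (I t ω) t ω

/-- The expected `n`-round regret: the sum over the arms of the gap times the expected number of
pulls in the first `n` rounds. -/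
def regret [MeasurableSpace Ω] (P : Measure Ω) (B : Bandit K) (I : ℕ → Ω → Fin K) (n : ℕ) : ℝ :=
  ∑ i, B.gap i * ∫ ω, (pulls I i n ω : ℝ) ∂P

end Algorithm

/-- The constant `c` of the regret bound, which depends only on the perturbation scale `a`. -/
def boundConst (a : ℝ) : ℝ :=
  Real.exp 2 * √(2 * a) / √Real.pi * Real.exp (16 / (a - 2)) *
    (1 + √(Real.pi * a / (8 * (a - 2))))

end PHE

end

/-!
The regret of perturbed-history exploration is bounded arm by arm. For an arm `i` with gap `D > 0`
and `n ≥ 2` rounds, the expected number of pulls is at most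
`8 * a * (2 * c + 1) * log n / D ^ 2 + 5` with `c = boundConst a` (`IsRun.integral_pulls_le`).
Arms with gap at most `ε` cost at most `ε * n` in total, the other arms at most
`8 * a * (2 * c + 1) * log n / ε + 5` each, and balancing the two sums in `ε` gives the regret
bound.

To count the pulls of arm `i`, its estimate is compared with the value that corresponds to the
midpoint between its mean and the optimal mean.

* If the estimate reaches this value after `8 * a * log n / D ^ 2` pulls, then the rewards of the
  arm or its pseudo-rewards deviate from their means, and both events have probability at most
  `1 / n` for each pull count by Hoeffding's inequality
  (`IsRun.sum_measure_pull_of_le_estimate_le`).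
* If the estimate stays below this value, then so does the estimate of every other arm, in
  particular that of an optimal arm `k`. Given the history and the estimates of the other arms, let
  `q` be the probability that arm `k` reaches the value. A round in which all estimates stay below
  it is `1 / q - 1` times as likely as a round in which only arm `k` reaches it and is therefore
  pulled, and there is only one such pull for each pull count
  (`IsRun.sum_measure_estimate_lt_le`). After `16 * a * log n / D ^ 2` pulls of arm `k` the factor
  is below `1 / n` up to small probability; before that its expectation is at most `c`.

That expectation is the analytic core (`lintegral_inv_coinTail_le`). If the `s` rewards of arm `k`
fall short of their mean by `x`, then `a * s` fair coins make up for it with probability at least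
a constant times `exp (-(w ^ 2 + 3.5 * w))`, where `w = 2 * x / √(a * s)`
(`le_coinTail`, by an exponential change of measure; for the few small `a * s` that it does not
cover, all coins may come up heads), whereas a shortfall of `x` has a subgaussian tail
`exp (-2 * x ^ 2 / s)`. Since `w ^ 2 = (4 / a) * x ^ 2 / s` and `4 / a < 2`, the expectation of the inverse is finite.

Rewards are indexed by rounds and the rounds of the pulls are random, so the rewards collected in
the first `s` pulls are compared with `s` independent rewards through
`IsRun.measure_exists_pulls_le`, by induction on `s`.
-/

namespace PHE

/-! ### Sums of fair coins -/

/-- The expectation of `f B` for a binomial variable `B` with parameters `m` and `1/2`, computed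
by conditioning on one coin at a time. Being a finite recursion, it needs no integrability
assumptions. -/
noncomputable def coinExp : ℕ → (ℝ → ℝ) → ℝ
  | 0, f => f 0
  | m + 1, f => (coinExp m f + coinExp m (fun x => f (x + 1))) / 2

/-- The probability that `m` fair coins show at least `r` heads. -/
noncomputable def coinTail (m : ℕ) (r : ℝ) : ℝ :=
  coinExp m ((Set.Ici r).indicator 1)

lemma coinExp_mono (m : ℕ) {f g : ℝ → ℝ} (h : ∀ x, f x ≤ g x) : coinExp m f ≤ coinExp m g := by
  induction m generalizing f g with
  | zero => exact h 0
  | succ m ih =>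
    have h1 := ih h
    have h2 := ih (f := fun x => f (x + 1)) (g := fun x => g (x + 1)) fun x => h (x + 1)
    simp only [coinExp]
    linarith

lemma coinExp_add (m : ℕ) (f g : ℝ → ℝ) :
    coinExp m (fun x => f x + g x) = coinExp m f + coinExp m g := by
  induction m generalizing f g with
  | zero => rfl
  | succ m ih =>
    simp only [coinExp, ih f g, ih (fun x => f (x + 1)) (fun x => g (x + 1))]
    ring

lemma coinExp_const_mul (m : ℕ) (c : ℝ) (f : ℝ → ℝ) :
    coinExp m (fun x => c * f x) = c * coinExp m f := by
  induction m generalizing f with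
  | zero => rfl
  | succ m ih =>
    simp only [coinExp, ih f, ih (fun x => f (x + 1))]
    ring

lemma coinExp_const (m : ℕ) (c : ℝ) : coinExp m (fun _ => c) = c := by
  induction m with
  | zero => rfl
  | succ m ih => simp only [coinExp, ih]; ring

lemma coinExp_exp (m : ℕ) (l : ℝ) :
    coinExp m (fun x => Real.exp (l * x)) = ((1 + Real.exp l) / 2) ^ m := by
  induction m with
  | zero => simp [coinExp]
  | succ m ih =>
    have h : (fun x : ℝ => Real.exp (l * (x + 1))) = fun x => Real.exp l * Real.exp (l * x) := by
      funext x; rw [← Real.exp_add]; ring_nf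
    simp only [coinExp, h, coinExp_const_mul, ih]
    ring

/-- The second moment of the tilted binomial distribution with success probability `p`: weighting
by `exp (l * x)` with `exp l = p / (1 - p)` turns fair coins into coins of bias `p`. -/
lemma coinExp_exp_mul_sq (m : ℕ) {p l : ℝ} (hp : p < 1) (hl : Real.exp l = p / (1 - p)) (c : ℝ) :
    coinExp m (fun x => Real.exp (l * x) * (x - m * p + c) ^ 2) =
      (1 / (2 * (1 - p))) ^ m * (m * p * (1 - p) + c ^ 2) := by
  have hp' : (1 - p) ≠ 0 := by linarith
  induction m generalizing c with
  | zero => simp [coinExp]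
  | succ m ih =>
    have h1 : (fun x : ℝ => Real.exp (l * x) * (x - ((m + 1 : ℕ) : ℝ) * p + c) ^ 2) =
        fun x => Real.exp (l * x) * (x - m * p + (c - p)) ^ 2 := by
      funext x; push_cast; ring
    have h2 : (fun x : ℝ => Real.exp (l * (x + 1)) * (x + 1 - ((m + 1 : ℕ) : ℝ) * p + c) ^ 2) =
        fun x => p / (1 - p) * (Real.exp (l * x) * (x - m * p + (c + (1 - p))) ^ 2) := by
      funext x
      rw [← hl, mul_add, Real.exp_add]; push_cast; ring_nf
    simp only [coinExp, h1, h2, coinExp_const_mul, ih]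
    push_cast
    rw [pow_succ _ m]
    generalize (1 / (2 * (1 - p))) ^ m = q
    field_simp
    ring

lemma coinTail_nonneg (m : ℕ) (r : ℝ) : 0 ≤ coinTail m r := by
  rw [← coinExp_const m 0]
  exact coinExp_mono m fun x => Set.indicator_nonneg (fun _ _ => zero_le_one) x

lemma coinTail_le_one (m : ℕ) (r : ℝ) : coinTail m r ≤ 1 := by
  rw [← coinExp_const m 1]
  exact coinExp_mono m fun x => Set.indicator_le_self' (fun _ _ => zero_le_one) x

lemma coinTail_antitone (m : ℕ) : Antitone (coinTail m) := fun _ _ h =>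
  coinExp_mono m fun x => Set.indicator_le_indicator_of_subset (Set.Ici_subset_Ici.2 h)
    (fun _ => zero_le_one) x

lemma coinTail_succ (m : ℕ) (r : ℝ) :
    coinTail (m + 1) r = (coinTail m r + coinTail m (r - 1)) / 2 := by
  have h : (fun x : ℝ => (Set.Ici r).indicator (1 : ℝ → ℝ) (x + 1)) =
      (Set.Ici (r - 1)).indicator 1 := by
    funext x
    simp only [Set.indicator_apply, Set.mem_Ici, sub_le_iff_le_add, Pi.one_apply]
  simp only [coinTail, coinExp, h]

/-- All coins may come up heads. -/
lemma two_pow_inv_le_coinTail (m : ℕ) {r : ℝ} (hr : r ≤ m) : (2 ^ m)⁻¹ ≤ coinTail m r := by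
  induction m generalizing r with
  | zero =>
    have : (0 : ℝ) ∈ Set.Ici r := by simpa using hr
    simp [coinTail, coinExp, Set.indicator_of_mem this]
  | succ m ih =>
    have h1 := ih (r := r - 1) (by push_cast at hr; linarith)
    have h2 := coinTail_nonneg m r
    rw [coinTail_succ, pow_succ, mul_inv]
    linarith

lemma coinExp_exp_le (m : ℕ) (l : ℝ) :
    coinExp m (fun x => Real.exp (l * x)) ≤ Real.exp (l * m / 2 + l ^ 2 * m / 8) := by
  rw [coinExp_exp]
  have h1 : (1 + Real.exp l) / 2 ≤ Real.exp (l / 2 + l ^ 2 / 8) := by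
    have h2 := Real.cosh_le_exp_half_sq (l / 2)
    have h3 : (1 + Real.exp l) / 2 = Real.exp (l / 2) * Real.cosh (l / 2) := by
      rw [Real.cosh_eq, Real.exp_neg]
      have : Real.exp l = Real.exp (l / 2) * Real.exp (l / 2) := by
        rw [← Real.exp_add]; ring_nf
      rw [this]
      field_simp
      ring
    rw [h3, Real.exp_add]
    refine mul_le_mul_of_nonneg_left (h2.trans (le_of_eq ?_)) (Real.exp_nonneg _)
    ring_nf
  calc ((1 + Real.exp l) / 2) ^ m ≤ Real.exp (l / 2 + l ^ 2 / 8) ^ m :=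
        pow_le_pow_left₀ (by positivity) h1 m
    _ = _ := by rw [← Real.exp_nat_mul]; ring_nf

/-- Hoeffding's inequality for the upper tail of fair coins. -/
lemma coinTail_le_exp {m : ℕ} (hm : 0 < m) {x : ℝ} (hx : 0 ≤ x) :
    coinTail m (m / 2 + x) ≤ Real.exp (-(2 * x ^ 2 / m)) := by
  have hm' : (0 : ℝ) < m := by exact_mod_cast hm
  set l : ℝ := 4 * x / m with hl
  have hl0 : 0 ≤ l := by positivity
  have h1 : coinTail m (m / 2 + x) ≤
      coinExp m (fun b => Real.exp (-(l * (m / 2 + x))) * Real.exp (l * b)) := by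
    refine coinExp_mono m fun b => ?_
    rw [← Real.exp_add]
    by_cases hb : b ∈ Set.Ici ((m : ℝ) / 2 + x)
    · rw [Set.indicator_of_mem hb]
      have hb' : (m : ℝ) / 2 + x ≤ b := hb
      refine Real.one_le_exp ?_
      nlinarith
    · rw [Set.indicator_of_notMem hb]
      positivity
  rw [coinExp_const_mul] at h1
  refine h1.trans ((mul_le_mul_of_nonneg_left (coinExp_exp_le m l) (Real.exp_nonneg _)).trans ?_)
  rw [← Real.exp_add, Real.exp_le_exp, hl]
  apply le_of_eq
  field_simp
  ring

/-- Hoeffding's inequality for the lower tail of fair coins. -/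
lemma one_sub_coinTail_le_exp {m : ℕ} (hm : 0 < m) {x : ℝ} (hx : 0 ≤ x) :
    1 - coinTail m (m / 2 - x) ≤ Real.exp (-(2 * x ^ 2 / m)) := by
  have hm' : (0 : ℝ) < m := by exact_mod_cast hm
  set l : ℝ := -(4 * x / m) with hl
  have hl0 : 0 ≤ 4 * x / m := by positivity
  have h1 : (1 : ℝ) = coinExp m (fun _ => 1) := (coinExp_const m 1).symm
  have h2 : coinExp m (fun _ => 1) ≤ coinExp m (fun b => (Set.Ici ((m : ℝ) / 2 - x)).indicator 1 b +
      Real.exp (-(l * (m / 2 - x))) * Real.exp (l * b)) := by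
    refine coinExp_mono m fun b => ?_
    rw [← Real.exp_add]
    by_cases hb : b ∈ Set.Ici ((m : ℝ) / 2 - x)
    · rw [Set.indicator_of_mem hb]
      simp only [Pi.one_apply]
      have := Real.exp_nonneg (-(l * (m / 2 - x)) + l * b)
      linarith
    · rw [Set.indicator_of_notMem hb, zero_add]
      have hb' : b < (m : ℝ) / 2 - x := not_le.1 hb
      refine Real.one_le_exp ?_
      rw [hl]
      nlinarith
  rw [← h1, coinExp_add, coinExp_const_mul] at h2
  have h3 : Real.exp (-(l * (m / 2 - x))) * coinExp m (fun b => Real.exp (l * b)) ≤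
      Real.exp (-(2 * x ^ 2 / m)) := by
    refine (mul_le_mul_of_nonneg_left (coinExp_exp_le m l) (Real.exp_nonneg _)).trans ?_
    rw [← Real.exp_add, Real.exp_le_exp, hl]
    apply le_of_eq
    field_simp
    ring
  have h4 : coinTail m (m / 2 - x) = coinExp m ((Set.Ici ((m : ℝ) / 2 - x)).indicator 1) := rfl
  linarith

/-- Since `u ↦ log ((1 + u) / (1 - u)) / u` is increasing, the bound only has to be checked at the
right end point. -/
lemma log_sub_log_le {u : ℝ} (hu : 0 ≤ u) (hu' : u ≤ 0.85) :
    Real.log (1 + u) - Real.log (1 - u) ≤ 3 * u := by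
  have s1 := Real.hasSum_log_sub_log_of_abs_lt_one (x := u) (by rw [abs_of_nonneg hu]; linarith)
  have s2 := (Real.hasSum_log_sub_log_of_abs_lt_one (x := 0.85)
    (by rw [abs_of_nonneg (by norm_num)]; norm_num)).mul_left (u / 0.85)
  have h1 := hasSum_le (fun k => by
    have : u ^ (2 * k) ≤ (0.85 : ℝ) ^ (2 * k) := pow_le_pow_left₀ hu hu' _
    have h3 : (u / 0.85) * (2 * (1 / (2 * (k : ℝ) + 1)) * (0.85 : ℝ) ^ (2 * k + 1)) =
        2 * (1 / (2 * (k : ℝ) + 1)) * u * 0.85 ^ (2 * k) := by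
      rw [pow_succ]; field_simp
    rw [h3, pow_succ, mul_comm (u ^ (2 * k)), ← mul_assoc]
    exact mul_le_mul_of_nonneg_left this (by positivity)) s1 s2
  have h2 : Real.log (1 + 0.85) - Real.log (1 - 0.85) ≤ 2.55 := by
    rw [← Real.log_div (by norm_num) (by norm_num), Real.log_le_iff_le_exp (by norm_num)]
    have e1 : (12 : ℝ) ≤ Real.exp 2.5 := by
      have e5 : Real.exp 2.5 ^ 2 = Real.exp 1 ^ 5 := by
        rw [← Real.exp_nat_mul, ← Real.exp_nat_mul]; norm_num
      have : (2.718 : ℝ) ^ 5 ≤ Real.exp 1 ^ 5 :=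
        pow_le_pow_left₀ (by norm_num) (by linarith [Real.exp_one_gt_d9]) 5
      refine le_of_sq_le_sq ?_ (Real.exp_nonneg _)
      rw [e5]
      refine le_trans ?_ this
      norm_num
    have e2 : (1.05 : ℝ) ≤ Real.exp 0.05 := by
      have := Real.add_one_le_exp (0.05 : ℝ); linarith
    have e3 : Real.exp 2.55 = Real.exp 2.5 * Real.exp 0.05 := by
      rw [← Real.exp_add]; norm_num
    rw [e3]
    nlinarith
  refine h1.trans ((mul_le_mul_of_nonneg_left h2 (by positivity)).trans (le_of_eq ?_))
  field_simp
  norm_num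
  ring

/-- A quadratic minorant of `x ↦ exp (-l * x)` on the half-line `[-h, ∞)`, nonpositive outside. -/
lemma quadratic_minorant {l h X : ℝ} (hl : 0 ≤ l) (hh : 0 < h) :
    Real.exp (l * X - l * h) *
      ((1 + l * h) * (1 - (X - h) ^ 2 / (4 * h ^ 2)) - l * ((X + h) ^ 2 / (4 * h))) ≤
      (Set.Ici (-h)).indicator 1 X := by
  have hw : 0 ≤ l * h := by positivity
  by_cases hb : X ∈ Set.Ici (-h)
  · rw [Set.indicator_of_mem hb, Pi.one_apply]
    have q1 : l * X ≤ l * ((X + h) ^ 2 / (4 * h)) := by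
      refine mul_le_mul_of_nonneg_left ?_ hl
      rw [le_div_iff₀ (by positivity)]; nlinarith [sq_nonneg (X - h)]
    have q2 : 0 ≤ (1 + l * h) * ((X - h) ^ 2 / (4 * h ^ 2)) := by positivity
    have q3 : (1 + l * h) * (1 - (X - h) ^ 2 / (4 * h ^ 2)) - l * ((X + h) ^ 2 / (4 * h)) ≤
        1 + l * h - l * X := by rw [mul_one_sub]; linarith
    have q4 : 1 + l * h - l * X ≤ Real.exp (l * h - l * X) := by
      have := Real.add_one_le_exp (l * h - l * X); linarith
    calc _ ≤ Real.exp (l * X - l * h) * Real.exp (l * h - l * X) :=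
          mul_le_mul_of_nonneg_left (q3.trans q4) (Real.exp_nonneg _)
      _ = 1 := by rw [← Real.exp_add]; simp
  · rw [Set.indicator_of_notMem hb]
    have hX' : X < -h := not_le.1 hb
    refine mul_nonpos_of_nonneg_of_nonpos (Real.exp_nonneg _) ?_
    have q1 : 1 ≤ (X - h) ^ 2 / (4 * h ^ 2) := by
      rw [one_le_div (by positivity)]; nlinarith
    have q2 : 0 ≤ l * ((X + h) ^ 2 / (4 * h)) := by positivity
    have q3 : (1 + l * h) * (1 - (X - h) ^ 2 / (4 * h ^ 2)) ≤ 0 :=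
      mul_nonpos_of_nonneg_of_nonpos (by linarith) (by linarith)
    linarith

set_option maxHeartbeats 1000000 in
/-- An anti-concentration inequality for fair coins. The coins are tilted to bias `(1 + u) / 2`,
which puts the mean one standard deviation `√m / 2` above the threshold; the tilted probability of
the tail and the tilted mean of the likelihood ratio on it are controlled together by
`quadratic_minorant`. -/
lemma le_coinTail {m : ℕ} (hm : 0 < m) {x u : ℝ} (hx : 0 ≤ x) (hu : u = 2 * x / m + 1 / √m)
    (hu' : u ≤ 0.85) :
    1 / 2 * Real.exp (-(m * u ^ 2 + 1.5 * (u * √m))) ≤ coinTail m (m / 2 + x) := by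
  have hm' : (0 : ℝ) < m := by exact_mod_cast hm
  have hs : 0 < √(m : ℝ) := Real.sqrt_pos.2 hm'
  have hss : √(m : ℝ) ^ 2 = m := Real.sq_sqrt hm'.le
  have hu0 : 0 ≤ u := by rw [hu]; positivity
  set p : ℝ := (1 + u) / 2 with hp
  set l : ℝ := Real.log (1 + u) - Real.log (1 - u) with hl
  set h : ℝ := √m / 2 with hh
  have hh0 : 0 < h := by positivity
  have hl0 : 0 ≤ l := sub_nonneg.2 (Real.log_le_log (by linarith) (by linarith))
  have hel : Real.exp l = p / (1 - p) := by
    rw [hl, Real.exp_sub, Real.exp_log (by linarith), Real.exp_log (by linarith), hp,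
      show 1 - (1 + u) / 2 = (1 - u) / 2 by ring, div_div_div_cancel_right₀ (by norm_num)]
  have hM : 1 / (2 * (1 - p)) = Real.exp (-Real.log (1 - u)) := by
    rw [Real.exp_neg, Real.exp_log (by linarith), hp, one_div]; ring_nf
  set w : ℝ := l * h with hw
  have hw0 : 0 ≤ w := by positivity
  have hthr : m * p - h = m / 2 + x := by
    have : (m : ℝ) * (1 / √m) = √m := by field_simp; linarith
    rw [hp, hh, hu]
    have h2 : (m : ℝ) * (2 * x / m) = 2 * x := by field_simp
    linear_combination (1 / 2) * this + (1 / 2) * h2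
  -- The quadratic minorant of the tail indicator, multiplied by the likelihood ratio.
  have hpt : ∀ b : ℝ, Real.exp (-(l * (m * p) + w)) * ((1 + w) * Real.exp (l * b) +
      (-((1 + w) / (4 * h ^ 2)) * (Real.exp (l * b) * (b - m * p + -h) ^ 2) +
        -(l / (4 * h)) * (Real.exp (l * b) * (b - m * p + h) ^ 2))) ≤
      (Set.Ici ((m : ℝ) / 2 + x)).indicator 1 b := by
    intro b
    set X : ℝ := b - m * p with hX
    have e1 : Real.exp (-(l * (m * p) + w)) * ((1 + w) * Real.exp (l * b) +
      (-((1 + w) / (4 * h ^ 2)) * (Real.exp (l * b) * (X + -h) ^ 2) +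
        -(l / (4 * h)) * (Real.exp (l * b) * (X + h) ^ 2))) = Real.exp (l * X - w) *
        ((1 + w) * (1 - (X - h) ^ 2 / (4 * h ^ 2)) - l * ((X + h) ^ 2 / (4 * h))) := by
      have : Real.exp (l * X - w) = Real.exp (-(l * (m * p) + w)) * Real.exp (l * b) := by
        rw [← Real.exp_add, hX]; ring_nf
      rw [this]; ring
    rw [e1]
    refine (quadratic_minorant hl0 hh0).trans (le_of_eq ?_)
    have : X ∈ Set.Ici (-h) ↔ b ∈ Set.Ici ((m : ℝ) / 2 + x) := by
      simp only [Set.mem_Ici, ← hthr, hX]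
      constructor <;> intro h' <;> linarith
    simp only [Set.indicator_apply, this, Pi.one_apply]
  have hE := coinExp_mono m hpt
  rw [coinExp_const_mul, coinExp_add, coinExp_add, coinExp_const_mul, coinExp_const_mul,
    coinExp_const_mul, coinExp_exp_mul_sq m (by linarith) hel,
    coinExp_exp_mul_sq m (by linarith) hel, coinExp_exp] at hE
  have hM' : (1 + Real.exp l) / 2 = 1 / (2 * (1 - p)) := by
    rw [hel]
    have : 1 - p ≠ 0 := by linarith
    field_simp
    ring
  rw [hM'] at hE
  have hv : m * p * (1 - p) ≤ h ^ 2 := by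
    rw [hp, hh, div_pow, hss]; nlinarith [sq_nonneg u]
  have hhalf : 1 / 2 ≤ (1 + w) + (-((1 + w) / (4 * h ^ 2)) * (m * p * (1 - p) + (-h) ^ 2) +
      -(l / (4 * h)) * (m * p * (1 - p) + h ^ 2)) := by
    have a1 : (1 + w) / (4 * h ^ 2) * (m * p * (1 - p) + (-h) ^ 2) ≤ (1 + w) / 2 := by
      calc _ ≤ (1 + w) / (4 * h ^ 2) * (2 * h ^ 2) :=
            mul_le_mul_of_nonneg_left (by linarith [neg_sq h]) (by positivity)
        _ = _ := by field_simp; norm_num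
    have a2 : l / (4 * h) * (m * p * (1 - p) + h ^ 2) ≤ w / 2 := by
      calc _ ≤ l / (4 * h) * (2 * h ^ 2) :=
            mul_le_mul_of_nonneg_left (by linarith) (by positivity)
        _ = _ := by rw [hw]; field_simp; norm_num
    linarith
  have hkl : -(u ^ 2) ≤ -(l * p) + -Real.log (1 - u) := by
    have a1 := Real.log_le_sub_one_of_pos (by linarith : 0 < 1 + u)
    have a2 := Real.log_le_sub_one_of_pos (by linarith : 0 < 1 - u)
    have a3 : l * p + Real.log (1 - u) =
        p * Real.log (1 + u) + (1 - p) * Real.log (1 - u) := by rw [hl]; ring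
    have a4 : p * Real.log (1 + u) ≤ p * u := mul_le_mul_of_nonneg_left (by linarith) (by linarith)
    have a5 : (1 - p) * Real.log (1 - u) ≤ (1 - p) * (-u) :=
      mul_le_mul_of_nonneg_left (by linarith) (by linarith)
    have a6 : p * u + (1 - p) * (-u) = u ^ 2 := by rw [hp]; ring
    linarith
  have hwle : w ≤ 1.5 * (u * √m) := by
    have := log_sub_log_le hu0 hu'
    rw [hw, hh]
    nlinarith
  set T := (1 + w) + (-((1 + w) / (4 * h ^ 2)) * (m * p * (1 - p) + (-h) ^ 2) +
      -(l / (4 * h)) * (m * p * (1 - p) + h ^ 2)) with hT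
  have hE' : Real.exp (-(l * (m * p) + w)) * (1 / (2 * (1 - p))) ^ m * T ≤
      coinTail m (m / 2 + x) := by
    refine le_trans (le_of_eq ?_) hE
    rw [hT]; ring
  refine le_trans ?_ hE'
  rw [hM, ← Real.exp_nat_mul, ← Real.exp_add, mul_comm]
  refine mul_le_mul (Real.exp_le_exp.2 ?_) hhalf (by norm_num) (Real.exp_nonneg _)
  nlinarith

/-! ### Sums of rewards -/

/-- The law of the sum of `s` independent variables with law `μ`. -/
noncomputable def sumLaw (μ : Measure ℝ) : ℕ → Measure ℝ
  | 0 => Measure.dirac 0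
  | s + 1 => (sumLaw μ s).conv μ

instance isProbabilityMeasure_sumLaw (μ : Measure ℝ) [IsProbabilityMeasure μ] (s : ℕ) :
    IsProbabilityMeasure (sumLaw μ s) := by
  induction s with
  | zero => rw [sumLaw]; infer_instance
  | succ s ih => rw [sumLaw]; infer_instance

lemma lintegral_sumLaw_succ (μ : Measure ℝ) [IsProbabilityMeasure μ] (s : ℕ) {f : ℝ → ENNReal}
    (hf : Measurable f) :
    ∫⁻ v, f v ∂(sumLaw μ (s + 1)) = ∫⁻ v, ∫⁻ y, f (v + y) ∂μ ∂(sumLaw μ s) := by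
  rw [sumLaw, Measure.lintegral_conv hf]

lemma sumLaw_succ_apply (μ : Measure ℝ) [IsProbabilityMeasure μ] (s : ℕ) {S : Set ℝ}
    (hS : MeasurableSet S) :
    sumLaw μ (s + 1) S = ∫⁻ v, μ ((fun y => v + y) ⁻¹' S) ∂(sumLaw μ s) := by
  rw [← lintegral_indicator_one hS, lintegral_sumLaw_succ _ _ (measurable_one.indicator hS)]
  refine lintegral_congr fun v => ?_
  rw [← lintegral_indicator_one (measurable_const_add v hS)]
  rfl

lemma ae_sumLaw_mem_Icc (μ : Measure ℝ) [IsProbabilityMeasure μ] (hμ : ∀ᵐ y ∂μ, y ∈ Set.Icc 0 1)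
    (s : ℕ) : ∀ᵐ v ∂(sumLaw μ s), v ∈ Set.Icc 0 (s : ℝ) := by
  induction s with
  | zero => simp [sumLaw, ae_dirac_eq]
  | succ s ih =>
    rw [ae_iff]
    change sumLaw μ (s + 1) (Set.Icc 0 ((s + 1 : ℕ) : ℝ))ᶜ = 0
    rw [sumLaw_succ_apply _ _ measurableSet_Icc.compl, lintegral_eq_zero_iff'
      (by
        refine Measurable.aemeasurable ?_
        exact measurable_measure_prodMk_left (ν := μ) (s := {p : ℝ × ℝ | p.1 + p.2 ∈
          (Set.Icc 0 ((s + 1 : ℕ) : ℝ))ᶜ}) (measurable_add measurableSet_Icc.compl))]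
    filter_upwards [ih] with v hv
    rw [Pi.zero_apply, ← nonpos_iff_eq_zero]
    refine (measure_mono fun y hy => ?_).trans (le_of_eq (ae_iff.1 hμ))
    intro hy'
    refine hy ⟨?_, ?_⟩
    · linarith [hv.1, hy'.1]
    · push_cast; linarith [hv.2, hy'.2]

/-- The moment generating function of a sum of rewards in `[0, 1]` (Hoeffding's lemma). -/
lemma lintegral_exp_sumLaw_le (μ : Measure ℝ) [IsProbabilityMeasure μ]
    (hμ : ∀ᵐ y ∂μ, y ∈ Set.Icc 0 1) (l : ℝ) (s : ℕ) :
    ∫⁻ v, ENNReal.ofReal (Real.exp (l * (v - s * ∫ y, y ∂μ))) ∂(sumLaw μ s) ≤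
      ENNReal.ofReal (Real.exp (l ^ 2 * s / 8)) := by
  set M := ∫ y, y ∂μ with hM
  have hone : ∫⁻ y, ENNReal.ofReal (Real.exp (l * (y - M))) ∂μ ≤
      ENNReal.ofReal (Real.exp (l ^ 2 / 8)) := by
    have h := hasSubgaussianMGF_of_mem_Icc (μ := μ) (X := fun y : ℝ => y) (a := 0) (b := 1)
      measurable_id.aemeasurable hμ
    rw [← ofReal_integral_eq_lintegral_ofReal (h.integrable_exp_mul l)
      (ae_of_all _ fun _ => Real.exp_nonneg _)]
    refine ENNReal.ofReal_le_ofReal ((h.mgf_le l).trans (le_of_eq ?_))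
    congr 1
    simp
    ring
  induction s with
  | zero => simp [sumLaw]
  | succ s ih =>
    rw [lintegral_sumLaw_succ _ _ (by fun_prop)]
    calc _ = ∫⁻ v, ENNReal.ofReal (Real.exp (l * (v - s * M))) *
          ∫⁻ y, ENNReal.ofReal (Real.exp (l * (y - M))) ∂μ ∂(sumLaw μ s) := by
          refine lintegral_congr fun v => ?_
          rw [← lintegral_const_mul _ (by fun_prop)]
          refine lintegral_congr fun y => ?_
          rw [← ENNReal.ofReal_mul (Real.exp_nonneg _), ← Real.exp_add]
          push_cast
          ring_nf
      _ ≤ ENNReal.ofReal (Real.exp (l ^ 2 * s / 8)) * ENNReal.ofReal (Real.exp (l ^ 2 / 8)) := by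
          rw [lintegral_mul_const _ (by fun_prop)]
          exact mul_le_mul' ih hone
      _ = _ := by
          rw [← ENNReal.ofReal_mul (Real.exp_nonneg _), ← Real.exp_add]
          push_cast
          ring_nf

/-- A common form of the two tails in Hoeffding's inequality: `ε` is the sign of the deviation. -/
lemma sumLaw_deviation_le (μ : Measure ℝ) [IsProbabilityMeasure μ]
    (hμ : ∀ᵐ y ∂μ, y ∈ Set.Icc 0 1) {s : ℕ} (hs : 0 < s) {x ε : ℝ} (hx : 0 ≤ x)
    (hε : ε ^ 2 = 1) :
    sumLaw μ s {v | x ≤ ε * (v - s * ∫ y, y ∂μ)} ≤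
      ENNReal.ofReal (Real.exp (-(2 * x ^ 2 / s))) := by
  set M := ∫ y, y ∂μ with hM
  have hs' : (0 : ℝ) < s := by exact_mod_cast hs
  set l : ℝ := 4 * x / s with hl
  have hl0 : 0 ≤ l := by positivity
  have h1 : sumLaw μ s {v | x ≤ ε * (v - s * M)} ≤
      ∫⁻ v, ENNReal.ofReal (Real.exp (-(l * x))) *
        ENNReal.ofReal (Real.exp (l * ε * (v - s * M))) ∂(sumLaw μ s) := by
    have hmeas : MeasurableSet {v : ℝ | x ≤ ε * (v - s * M)} :=
      measurableSet_le measurable_const (by fun_prop)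
    rw [← lintegral_indicator_one hmeas]
    refine lintegral_mono fun v => ?_
    by_cases hv : v ∈ {v : ℝ | x ≤ ε * (v - s * M)}
    swap
    · rw [Set.indicator_of_notMem hv]
      exact zero_le
    have hv' : x ≤ ε * (v - s * M) := hv
    rw [Set.indicator_of_mem hv]
    rw [← ENNReal.ofReal_mul (Real.exp_nonneg _), ← Real.exp_add, Pi.one_apply,
      ENNReal.one_le_ofReal]
    refine Real.one_le_exp ?_
    nlinarith
  refine h1.trans ?_
  rw [lintegral_const_mul _ (by fun_prop)]
  refine (mul_le_mul_right (lintegral_exp_sumLaw_le μ hμ (l * ε) s) _).trans (le_of_eq ?_)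
  rw [← ENNReal.ofReal_mul (Real.exp_nonneg _), ← Real.exp_add, mul_pow, hε, hl]
  congr 2
  field_simp
  ring

/-- The exponential moment of the squared deviation, by writing `exp (w ^ 2 / 2)` as a Gaussian
average of `exp (w * g)` and exchanging the order of integration. -/
lemma lintegral_exp_sq_sumLaw_le (μ : Measure ℝ) [IsProbabilityMeasure μ]
    (hμ : ∀ᵐ y ∂μ, y ∈ Set.Icc 0 1) {s : ℕ} (hs : 0 < s) {γ : ℝ} (hγ : 0 ≤ γ) (hγ' : γ < 2) :
    ∫⁻ v, ENNReal.ofReal (Real.exp (γ * (v - s * ∫ y, y ∂μ) ^ 2 / s)) ∂(sumLaw μ s) ≤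
      ENNReal.ofReal (√(2 / (2 - γ))) := by
  set M := ∫ y, y ∂μ with hM
  have hs' : (0 : ℝ) < s := by exact_mod_cast hs
  set r : ℝ := √(2 * γ / s) with hr
  have hr2 : r ^ 2 = 2 * γ / s := Real.sq_sqrt (by positivity)
  have gauss : ∀ b : ℝ, 0 < b → ∫⁻ g : ℝ, ENNReal.ofReal (Real.exp (-b * g ^ 2)) =
      ENNReal.ofReal (√(Real.pi / b)) := by
    intro b hb
    rw [← integral_gaussian, ofReal_integral_eq_lintegral_ofReal (integrable_exp_neg_mul_sq hb)
      (ae_of_all _ fun _ => Real.exp_nonneg _)]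
  have shift : ∀ w : ℝ, ∫⁻ g : ℝ, ENNReal.ofReal (Real.exp (w * g - g ^ 2 / 2)) =
      ENNReal.ofReal (Real.exp (w ^ 2 / 2)) * ENNReal.ofReal (√(2 * Real.pi)) := by
    intro w
    have h1 : ∀ g : ℝ, ENNReal.ofReal (Real.exp (w * g - g ^ 2 / 2)) =
        ENNReal.ofReal (Real.exp (w ^ 2 / 2)) *
          ENNReal.ofReal (Real.exp (-(1 / 2) * (g - w) ^ 2)) := by
      intro g
      rw [← ENNReal.ofReal_mul (Real.exp_nonneg _), ← Real.exp_add]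
      ring_nf
    simp_rw [h1]
    rw [lintegral_const_mul _ (by fun_prop),
      lintegral_sub_right_eq_self (fun g : ℝ => ENNReal.ofReal (Real.exp (-(1 / 2) * g ^ 2))) w,
      gauss _ (by norm_num)]
    congr 3
    ring
  have hpi : ENNReal.ofReal (√(2 * Real.pi)) ≠ 0 := by
    rw [Ne, ENNReal.ofReal_eq_zero, not_le]; positivity
  refine (ENNReal.mul_le_mul_iff_left hpi ENNReal.ofReal_ne_top).1 ?_
  rw [← lintegral_mul_const _ (by fun_prop)]
  calc _ = ∫⁻ v, (∫⁻ g : ℝ, ENNReal.ofReal (Real.exp (r * (v - s * M) * g - g ^ 2 / 2)))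
        ∂(sumLaw μ s) := by
        refine lintegral_congr fun v => ?_
        rw [shift, mul_pow, hr2]
        congr 3
        field_simp
    _ = ∫⁻ g : ℝ, ∫⁻ v, ENNReal.ofReal (Real.exp (r * (v - s * M) * g - g ^ 2 / 2))
        ∂(sumLaw μ s) := by
        rw [lintegral_lintegral_swap]
        exact Measurable.aemeasurable (by fun_prop)
    _ ≤ ∫⁻ g : ℝ, ENNReal.ofReal (Real.exp (-((2 - γ) / 4) * g ^ 2)) := by
        refine lintegral_mono fun g => ?_
        have h1 : ∀ v : ℝ, ENNReal.ofReal (Real.exp (r * (v - s * M) * g - g ^ 2 / 2)) =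
            ENNReal.ofReal (Real.exp (- g ^ 2 / 2)) *
              ENNReal.ofReal (Real.exp (r * g * (v - s * M))) := by
          intro v
          rw [← ENNReal.ofReal_mul (Real.exp_nonneg _), ← Real.exp_add]
          ring_nf
        simp_rw [h1]
        rw [lintegral_const_mul _ (by fun_prop)]
        refine (mul_le_mul_right (lintegral_exp_sumLaw_le μ hμ (r * g) s) _).trans (le_of_eq ?_)
        rw [← ENNReal.ofReal_mul (Real.exp_nonneg _), ← Real.exp_add, mul_pow, hr2]
        congr 2
        field_simp
        ring
    _ = _ := by
        rw [gauss _ (by linarith), ← ENNReal.ofReal_mul (Real.sqrt_nonneg _),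
          ← Real.sqrt_mul (div_nonneg (by norm_num) (by linarith))]
        congr 2
        have : 2 - γ ≠ 0 := by linarith
        field_simp
        norm_num

/-! ### The expected inverse probability of optimism -/

lemma one_div_sqrt_le {m δ : ℝ} (hm : 0 < m) (hδ : 0 < δ) (h : 1 ≤ δ ^ 2 * m) : 1 / √m ≤ δ := by
  rw [div_le_iff₀ (Real.sqrt_pos.2 hm)]
  refine le_of_sq_le_sq ?_ (by positivity)
  rw [mul_pow, Real.sq_sqrt hm.le]
  simpa using h

/-- The estimate of the expected inverse probability that results from `le_coinTail` and
`lintegral_exp_sq_sumLaw_le` is below `boundConst`. -/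
lemma le_boundConst {a : ℝ} (ha : 2 < a) :
    2 * Real.exp (2.5 + 12.25 / (a - 2)) * √(2 * a / (a - 2)) ≤ boundConst a := by
  set b := a - 2 with hb
  have hb0 : 0 < b := by linarith
  set D := √b * Real.exp (3.75 / b) with hD
  have hD0 : 0 ≤ D := by positivity
  have hD1 : 4.4 ≤ D := by
    refine le_of_sq_le_sq ?_ hD0
    have h1 : D ^ 2 = b * Real.exp (7.5 / b) := by
      rw [hD, mul_pow, Real.sq_sqrt hb0.le, ← Real.exp_nat_mul]
      congr 2
      push_cast
      ring
    -- `b * exp (t / b)` is smallest at `b = t`.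
    have h2 : 7.5 / b * Real.exp 1 ≤ Real.exp (7.5 / b) := by
      have := Real.add_one_le_exp (7.5 / b - 1)
      rw [Real.exp_sub, le_div_iff₀ (Real.exp_pos _)] at this
      simpa using this
    have h3 : b * (7.5 / b * Real.exp 1) = 7.5 * Real.exp 1 := by field_simp
    rw [h1]
    nlinarith [mul_le_mul_of_nonneg_left h2 hb0.le, Real.exp_one_gt_d9]
  have hS : 0.6 ≤ √(Real.pi * a / (8 * b)) := by
    refine Real.le_sqrt_of_sq_le ?_
    rw [le_div_iff₀ (by positivity)]
    nlinarith [Real.pi_gt_three]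
  have hpi : √Real.pi ≤ 1.78 := Real.sqrt_le_iff.2 ⟨by norm_num, by
    have := Real.pi_lt_d2; norm_num; linarith⟩
  have hpi0 : 0 < √Real.pi := Real.sqrt_pos.2 Real.pi_pos
  have he : Real.exp 0.5 ≤ 1.65 := by
    refine le_of_sq_le_sq ?_ (by norm_num)
    have : Real.exp 0.5 ^ 2 = Real.exp 1 := by rw [← Real.exp_nat_mul]; norm_num
    rw [this]
    have := Real.exp_one_lt_d9; norm_num; linarith
  have key : 2 * Real.exp 0.5 * √Real.pi ≤ D * (1 + √(Real.pi * a / (8 * b))) := by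
    have h1 : 2 * Real.exp 0.5 * √Real.pi ≤ 2 * 1.65 * 1.78 := by
      refine mul_le_mul (by linarith) hpi hpi0.le (by norm_num)
    have h2 : 4.4 * 1.6 ≤ D * (1 + √(Real.pi * a / (8 * b))) :=
      mul_le_mul hD1 (by linarith) (by norm_num) hD0
    refine h1.trans (le_trans (by norm_num) h2)
  have hb1 : 0 < √b := Real.sqrt_pos.2 hb0
  have h1 : 2 * Real.exp (2.5 + 12.25 / b) * √(2 * a / b) =
      (2 * Real.exp 0.5 * √Real.pi) *
        (Real.exp 2 * Real.exp (12.25 / b) * √(2 * a) / (√b * √Real.pi)) := by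
    rw [Real.sqrt_div (by linarith), show (2.5 : ℝ) + 12.25 / b = 0.5 + 2 + 12.25 / b by ring,
      Real.exp_add, Real.exp_add]
    field_simp
  have h2 : boundConst a = (D * (1 + √(Real.pi * a / (8 * b)))) *
        (Real.exp 2 * Real.exp (12.25 / b) * √(2 * a) / (√b * √Real.pi)) := by
    rw [boundConst, ← hb, show (16 : ℝ) / b = 3.75 / b + 12.25 / b by ring, Real.exp_add, hD]
    field_simp
  rw [h1, h2]
  exact mul_le_mul_of_nonneg_right key (by positivity)

/-- With `a = 3`, up to 27 coins are too few for `le_coinTail`; the constant is then so large that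
the trivial bound suffices. -/
lemma two_pow_le_boundConst_three : (2 : ℝ) ^ 27 ≤ boundConst 3 := by
  have hpi := Real.pi_lt_d2
  have hpi3 := Real.pi_gt_three
  have hpi0 : 0 < √Real.pi := Real.sqrt_pos.2 Real.pi_pos
  have h1 : (1.38 : ℝ) ≤ √(2 * 3) / √Real.pi := by
    rw [← Real.sqrt_div (by norm_num)]
    refine Real.le_sqrt_of_sq_le ?_
    rw [le_div_iff₀ Real.pi_pos]
    nlinarith
  have h2 : (1 : ℝ) ≤ √(Real.pi * 3 / (8 * (3 - 2))) :=
    Real.le_sqrt_of_sq_le (by linarith)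
  have h3 : (2.718 : ℝ) ^ 18 ≤ Real.exp 2 * Real.exp (16 / (3 - 2)) := by
    have : Real.exp 2 * Real.exp (16 / (3 - 2)) = Real.exp 1 ^ 18 := by
      rw [← Real.exp_add, ← Real.exp_nat_mul]; norm_num
    rw [this]
    exact pow_le_pow_left₀ (by norm_num) (by linarith [Real.exp_one_gt_d9]) 18
  have h4 : boundConst 3 = Real.exp 2 * Real.exp (16 / (3 - 2)) * (√(2 * 3) / √Real.pi) *
      (1 + √(Real.pi * 3 / (8 * (3 - 2)))) := by rw [boundConst]; ring
  rw [h4]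
  calc (2 : ℝ) ^ 27 ≤ 2.718 ^ 18 * 1.38 * 2 := by norm_num
    _ ≤ _ := by gcongr; linarith

lemma two_pow_le_boundConst_four : (2 : ℝ) ^ 8 ≤ boundConst 4 := by
  have hpi := Real.pi_lt_d2
  have hpi0 : 0 < √Real.pi := Real.sqrt_pos.2 Real.pi_pos
  have h1 : (1 : ℝ) ≤ √(2 * 4) / √Real.pi := by
    rw [one_le_div hpi0]
    exact Real.sqrt_le_sqrt (by linarith)
  have h2 : (0 : ℝ) ≤ √(Real.pi * 4 / (8 * (4 - 2))) := Real.sqrt_nonneg _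
  have h3 : (2 : ℝ) ^ 8 ≤ Real.exp 2 * Real.exp (16 / (4 - 2)) := by
    have : Real.exp 2 * Real.exp (16 / (4 - 2)) = Real.exp 1 ^ 10 := by
      rw [← Real.exp_add, ← Real.exp_nat_mul]; norm_num
    rw [this]
    calc (2 : ℝ) ^ 8 ≤ 2 ^ 10 := by norm_num
      _ ≤ _ := pow_le_pow_left₀ (by norm_num) (by linarith [Real.exp_one_gt_d9]) 10
  have h4 : boundConst 4 = Real.exp 2 * Real.exp (16 / (4 - 2)) * (√(2 * 4) / √Real.pi) *
      (1 + √(Real.pi * 4 / (8 * (4 - 2)))) := by rw [boundConst]; ring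
  rw [h4]
  calc (2 : ℝ) ^ 8 = 2 ^ 8 * 1 * 1 := by norm_num
    _ ≤ _ := by gcongr; linarith

/-- For a sum of `s` rewards with mean `M`, the inverse of the probability that `a * s` fair coins
compensate its deviation from `s * M` has expectation at most `boundConst a`. In exponent, the
inverse grows like `(4 / a) * x ^ 2 / s` in the deviation `x` while the tail of `x` decays like
`2 * x ^ 2 / s`, so that the expectation is finite because `2 < a`. -/
lemma lintegral_inv_coinTail_le (μ : Measure ℝ) [IsProbabilityMeasure μ]
    (hμ : ∀ᵐ y ∂μ, y ∈ Set.Icc 0 1) {a s : ℕ} (ha : 2 < a) (hs : 0 < s) :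
    ∫⁻ v, ENNReal.ofReal (1 / coinTail (a * s)
      (((a * s : ℕ) : ℝ) / 2 + (s * (∫ y, y ∂μ) - v))) ∂(sumLaw μ s) ≤
      ENNReal.ofReal (boundConst a) := by
  set M := ∫ y, y ∂μ with hM
  set m : ℕ := a * s with hm
  have hs' : (0 : ℝ) < s := by exact_mod_cast hs
  have hs1 : (1 : ℝ) ≤ s := by exact_mod_cast hs
  have ha3 : (3 : ℝ) ≤ a := by exact_mod_cast ha
  have hmr : (m : ℝ) = a * s := by rw [hm]; push_cast; ring
  have hm0 : 0 < m := Nat.mul_pos (by omega) hs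
  have hm0' : (0 : ℝ) < m := by exact_mod_cast hm0
  have hint : Integrable (fun y : ℝ => y) μ :=
    Integrable.of_mem_Icc 0 1 measurable_id.aemeasurable hμ
  have hM0 : 0 ≤ M := integral_nonneg_of_ae (hμ.mono fun y hy => hy.1)
  have hM1 : M ≤ 1 := by
    have := integral_mono_ae hint (integrable_const (1 : ℝ)) (hμ.mono fun y hy => hy.2)
    simpa using this
  have hdev : ∀ v ∈ Set.Icc (0 : ℝ) s, |s * M - v| ≤ s := by
    intro v hv
    rw [abs_le]
    constructor <;> nlinarith [hv.1, hv.2]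
  -- If `m` is so small that the tilted bias could leave the range of `le_coinTail`, it is enough
  -- that all coins may come up heads.
  have hsmall : (2 : ℝ) ^ m ≤ boundConst a →
      ∫⁻ v, ENNReal.ofReal (1 / coinTail m ((m : ℝ) / 2 + (s * M - v))) ∂(sumLaw μ s) ≤
      ENNReal.ofReal (boundConst a) := by
    intro hc
    calc _ ≤ ∫⁻ _, ENNReal.ofReal (boundConst a) ∂(sumLaw μ s) := by
          refine lintegral_mono_ae ?_
          filter_upwards [ae_sumLaw_mem_Icc μ hμ s] with v hv
          refine ENNReal.ofReal_le_ofReal (le_trans ?_ hc)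
          have h1 := two_pow_inv_le_coinTail m (r := (m : ℝ) / 2 + (s * M - v))
            (by have := (abs_le.1 (hdev v hv)).2; nlinarith)
          rw [one_div]
          exact inv_le_of_inv_le₀ (by positivity) h1
      _ = _ := by simp
  by_cases hu : 2 / (a : ℝ) + 1 / √m ≤ 0.85
  · have hb0 : (0 : ℝ) < a - 2 := by linarith
    have hbound : ∀ v ∈ Set.Icc (0 : ℝ) s,
        1 / coinTail m ((m : ℝ) / 2 + (s * M - v)) ≤
          2 * Real.exp (2.5 + 12.25 / (a - 2)) *
            Real.exp ((a + 2) / a * (v - s * M) ^ 2 / s) := by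
      intro v hv
      set x : ℝ := |s * M - v| with hx
      have hx0 : 0 ≤ x := abs_nonneg _
      have hxs : x ≤ s := hdev v hv
      have hu2 : 2 * x / m + 1 / √m ≤ 0.85 := by
        refine le_trans (add_le_add_left ?_ _) hu
        rw [hmr, div_le_div_iff₀ (by positivity) (by positivity)]
        nlinarith
      have h1 := le_coinTail hm0 hx0 rfl hu2
      have h2 := h1.trans (coinTail_antitone m
        (add_le_add_right (le_abs_self (s * M - v)) ((m : ℝ) / 2)))
      have hsm : 0 < √(m : ℝ) := Real.sqrt_pos.2 hm0'
      have hss : √(m : ℝ) ^ 2 = m := Real.sq_sqrt hm0'.le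
      set w : ℝ := 2 * x / √m with hw
      have hwu : (2 * x / m + 1 / √m) * √m = w + 1 := by
        rw [hw, add_mul, div_mul_cancel₀ _ hsm.ne']
        congr 1
        rw [div_mul_eq_mul_div, div_eq_div_iff hm0'.ne' hsm.ne', mul_assoc, ← sq, hss]
      have hwu2 : m * (2 * x / m + 1 / √m) ^ 2 = (w + 1) ^ 2 := by
        rw [← hwu, mul_pow, hss, mul_comm]
      have hw2 : w ^ 2 = 4 / a * (x ^ 2 / s) := by
        rw [hw, div_pow, hss, hmr]
        field_simp
        ring
      -- Young's inequality absorbs the linear term in the deviation.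
      have hyoung : 3.5 * w ≤ (a - 2) / 4 * w ^ 2 + 12.25 / (a - 2) := by
        have := sq_nonneg ((a - 2) / 2 * w - 3.5)
        have h3 : (a - 2) / 4 * w ^ 2 + 12.25 / (a - 2) - 3.5 * w =
            ((a - 2) / 2 * w - 3.5) ^ 2 / (a - 2) := by
          field_simp
          ring
        have h4 : 0 ≤ ((a - 2) / 2 * w - 3.5) ^ 2 / (a - 2) := div_nonneg this hb0.le
        linarith
      have hexp : m * (2 * x / m + 1 / √m) ^ 2 + 1.5 * ((2 * x / m + 1 / √m) * √m) ≤
          (2.5 + 12.25 / (a - 2)) + (a + 2) / a * (v - s * M) ^ 2 / s := by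
        rw [hwu2, hwu]
        have h3 : (a + 2) / a * (v - s * M) ^ 2 / s = w ^ 2 + (a - 2) / 4 * w ^ 2 := by
          rw [hw2, hx, sq_abs]
          field_simp
          ring
        rw [h3]
        nlinarith
      have h5 : 1 / coinTail m ((m : ℝ) / 2 + (s * M - v)) ≤
          1 / (1 / 2 * Real.exp (-(m * (2 * x / m + 1 / √m) ^ 2 +
            1.5 * ((2 * x / m + 1 / √m) * √m)))) :=
        one_div_le_one_div_of_le (by positivity) h2
      refine h5.trans ?_
      rw [Real.exp_neg, mul_assoc, ← Real.exp_add]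
      have h6 : ∀ E : ℝ, 1 / (1 / 2 * (Real.exp E)⁻¹) = 2 * Real.exp E := by
        intro E
        have := Real.exp_pos E
        field_simp
      rw [h6]
      exact mul_le_mul_of_nonneg_left (Real.exp_le_exp.2 hexp) (by norm_num)
    have hγ : ((a : ℝ) + 2) / a < 2 := by
      rw [div_lt_iff₀ (by linarith)]; linarith
    calc _ ≤ ∫⁻ v, ENNReal.ofReal (2 * Real.exp (2.5 + 12.25 / (a - 2))) *
          ENNReal.ofReal (Real.exp ((a + 2) / a * (v - s * M) ^ 2 / s)) ∂(sumLaw μ s) := by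
          refine lintegral_mono_ae ?_
          filter_upwards [ae_sumLaw_mem_Icc μ hμ s] with v hv
          rw [← ENNReal.ofReal_mul (by positivity)]
          exact ENNReal.ofReal_le_ofReal (hbound v hv)
      _ ≤ ENNReal.ofReal (2 * Real.exp (2.5 + 12.25 / (a - 2))) *
          ENNReal.ofReal (√(2 / (2 - (a + 2) / a))) := by
          rw [lintegral_const_mul _ (by fun_prop)]
          exact mul_le_mul_right (lintegral_exp_sq_sumLaw_le μ hμ hs (by positivity) hγ) _
      _ ≤ _ := by
          rw [← ENNReal.ofReal_mul (by positivity)]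
          refine ENNReal.ofReal_le_ofReal (le_trans (le_of_eq ?_) (le_boundConst (by linarith)))
          congr 2
          have : (a : ℝ) ≠ 0 := by linarith
          have h7 : 2 - ((a : ℝ) + 2) / a = (a - 2) / a := by field_simp; ring
          rw [h7, div_div_eq_mul_div]
  · apply hsmall
    push Not at hu
    rcases Nat.lt_or_ge 4 a with h5 | h4
    · exfalso
      have h5' : (5 : ℝ) ≤ a := by exact_mod_cast h5
      have h1 : 1 / √(m : ℝ) ≤ 0.45 :=
        one_div_sqrt_le hm0' (by norm_num) (by rw [hmr]; nlinarith)
      have h2 : 2 / (a : ℝ) ≤ 0.4 := by rw [div_le_iff₀ (by linarith)]; linarith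
      linarith
    · obtain rfl | rfl : a = 3 ∨ a = 4 := by omega
      · have hs9 : m ≤ 27 := by
          by_contra hcon
          have hs10 : (30 : ℝ) ≤ m := by
            have : 30 ≤ m := by omega
            exact_mod_cast this
          have h1 : 1 / √(m : ℝ) ≤ 0.183 :=
            one_div_sqrt_le hm0' (by norm_num) (by nlinarith)
          norm_num at hu h1
          linarith
        refine le_trans ?_ (by simpa using two_pow_le_boundConst_three)
        exact pow_le_pow_right₀ (by norm_num) hs9
      · have hs2 : m ≤ 8 := by
          by_contra hcon
          have hs3 : (12 : ℝ) ≤ m := by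
            have : 12 ≤ m := by omega
            exact_mod_cast this
          have h1 : 1 / √(m : ℝ) ≤ 0.3 :=
            one_div_sqrt_le hm0' (by norm_num) (by nlinarith)
          norm_num at hu h1
          linarith
        refine le_trans ?_ (by simpa using two_pow_le_boundConst_four)
        exact pow_le_pow_right₀ (by norm_num) hs2

/-! ### Independence of the sources of randomness -/

lemma sumLaw_fairCoin_Ici (m : ℕ) (r : ℝ) :
    sumLaw fairCoin m (Set.Ici r) = ENNReal.ofReal (coinTail m r) := by
  have : IsProbabilityMeasure fairCoin := by unfold fairCoin; infer_instance
  induction m generalizing r with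
  | zero =>
    simp only [sumLaw, coinTail, coinExp, Measure.dirac_apply' _ measurableSet_Ici,
      Set.indicator_apply, Pi.one_apply]
    split_ifs <;> simp
  | succ m ih =>
    have hpre : ∀ y : ℝ, ∫⁻ v, (Set.Ici r).indicator (1 : ℝ → ENNReal) (v + y)
        ∂(sumLaw fairCoin m) = ENNReal.ofReal (coinTail m (r - y)) := by
      intro y
      rw [← ih, ← lintegral_indicator_one measurableSet_Ici]
      refine lintegral_congr fun v => ?_
      simp only [Set.indicator_apply, Set.mem_Ici, sub_le_iff_le_add, Pi.one_apply]
    have hm : Measurable ((Set.Ici r).indicator (1 : ℝ → ENNReal)) :=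
      measurable_one.indicator measurableSet_Ici
    rw [← lintegral_indicator_one measurableSet_Ici, lintegral_sumLaw_succ _ _ hm,
      lintegral_lintegral_swap (by fun_prop)]
    simp_rw [hpre]
    have hm2 : Measurable fun y : ℝ => ENNReal.ofReal (coinTail m (r - y)) :=
      ENNReal.measurable_ofReal.comp ((coinTail_antitone m).measurable.comp (by fun_prop))
    rw [fairCoin, bernoulliMeasure_def, lintegral_add_measure, lintegral_smul_measure,
      lintegral_smul_measure, lintegral_dirac' _ hm2, lintegral_dirac' _ hm2, coinTail_succ,
      add_comm (coinTail m r), add_div, ENNReal.ofReal_add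
        (div_nonneg (coinTail_nonneg _ _) (by norm_num))
        (div_nonneg (coinTail_nonneg _ _) (by norm_num)), sub_zero]
    have h2 : unitInterval.toNNReal ⟨(1 : ℝ) / 2, by norm_num, by norm_num⟩ = 2⁻¹ := by
      ext; simp
    have h3 : unitInterval.toNNReal (unitInterval.symm ⟨(1 : ℝ) / 2, by norm_num, by norm_num⟩) =
        2⁻¹ := by
      ext; simp; norm_num
    have h4 : ∀ x : ℝ, ENNReal.ofReal (x / 2) = (2⁻¹ : NNReal) • ENNReal.ofReal x := by
      intro x
      rw [div_eq_inv_mul, ENNReal.ofReal_mul (by norm_num), ENNReal.smul_def, smul_eq_mul]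
      congr 1
      rw [ENNReal.ofReal, ← NNReal.coe_two, ← NNReal.coe_inv, Real.toNNReal_coe]
    rw [h2, h3, h4, h4]

variable {K : ℕ} {Ω E : Type*}

/-- Integrating out a real variable that is independent of everything else in the integrand. -/
lemma lintegral_mul_indicator_add {𝓜 : MeasurableSpace Ω} [mΩ : MeasurableSpace Ω]
    {P : Measure Ω} [IsProbabilityMeasure P] (h𝓜 : 𝓜 ≤ mΩ) {w : Ω → ENNReal} {V X : Ω → ℝ}
    (hw : Measurable[𝓜] w) (hV : Measurable[𝓜] V) (hX : Measurable X)
    (hind : Indep 𝓜 (MeasurableSpace.comap X inferInstance) P) {S : Set ℝ}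
    (hS : MeasurableSet S) :
    ∫⁻ ω, w ω * S.indicator 1 (V ω + X ω) ∂P =
      ∫⁻ ω, w ω * P.map X ((fun y => V ω + y) ⁻¹' S) ∂P := by
  have hpair : Measurable[𝓜] fun ω => (w ω, V ω) := hw.prodMk hV
  have hpair' : Measurable fun ω => (w ω, V ω) := hpair.mono h𝓜 le_rfl
  have hI : IndepFun (fun ω => (w ω, V ω)) X P :=
    indep_of_indep_of_le_left hind hpair.comap_le
  have : IsProbabilityMeasure (P.map X) := Measure.isProbabilityMeasure_map hX.aemeasurable
  have hmap := (indepFun_iff_map_prod_eq_prod_map_map hpair'.aemeasurable hX.aemeasurable).1 hI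
  have hSm : Measurable (S.indicator (1 : ℝ → ENNReal)) := measurable_one.indicator hS
  have hg : Measurable fun p : (ENNReal × ℝ) × ℝ => p.1.1 * S.indicator 1 (p.1.2 + p.2) := by
    fun_prop
  calc _ = ∫⁻ p, p.1.1 * S.indicator 1 (p.1.2 + p.2)
        ∂(P.map fun ω => ((w ω, V ω), X ω)) := by
        rw [lintegral_map hg (hpair'.prodMk hX)]
    _ = ∫⁻ q, (∫⁻ b, q.1 * S.indicator 1 (q.2 + b) ∂(P.map X))
        ∂(P.map fun ω => (w ω, V ω)) := by
        rw [hmap, lintegral_prod _ hg.aemeasurable]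
    _ = ∫⁻ ω, (∫⁻ b, w ω * S.indicator 1 (V ω + b) ∂(P.map X)) ∂P := by
        rw [lintegral_map hg.lintegral_prod_right' hpair']
    _ = _ := by
        refine lintegral_congr fun ω => ?_
        rw [lintegral_const_mul _ (by fun_prop),
          ← lintegral_indicator_one (measurable_const_add (V ω) hS)]
        rfl

/-- The σ-algebra generated by the sources with index in `S`. -/
@[reducible] def sourceSpan [MeasurableSpace E] (ξ : Ω → E) (Y : Fin K → ℕ → Ω → ℝ)
    (Z : Fin K → ℕ → ℕ → Ω → ℝ) (S : Set (Unit ⊕ (Fin K × ℕ) ⊕ (Fin K × ℕ × ℕ))) :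
    MeasurableSpace Ω :=
  ⨆ k ∈ S, sources ξ Y Z k

/-- The sources that may influence the choice of the arm in round `t`. -/
def infoIndex (t : ℕ) : Set (Unit ⊕ (Fin K × ℕ) ⊕ (Fin K × ℕ × ℕ)) :=
  {k | Sum.elim (fun _ => True) (Sum.elim (fun p => p.2 < t) (fun q => q.2.1 ≤ t)) k}

/-- The sources that determine the history before round `t` and the estimates in round `t` of all
arms other than `i`. -/
def othersIndex (i : Fin K) (t : ℕ) : Set (Unit ⊕ (Fin K × ℕ) ⊕ (Fin K × ℕ × ℕ)) :=
  {k | Sum.elim (fun _ => True)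
    (Sum.elim (fun p => p.2 < t) (fun q => q.2.1 < t ∨ (q.2.1 = t ∧ q.1 ≠ i))) k}

lemma infoIndex_subset_othersIndex {r t : ℕ} (h : r < t) (i : Fin K) :
    infoIndex r ⊆ othersIndex i t := by
  rintro (k | p | q) hk
  · trivial
  · exact lt_trans (show p.2 < r from hk) h
  · exact Or.inl (lt_of_le_of_lt (show q.2.1 ≤ r from hk) h)

lemma infoIndex_mono {r t : ℕ} (h : r ≤ t) : infoIndex (K := K) r ⊆ infoIndex t := by
  rintro (k | p | q) hk
  · trivial
  · exact lt_of_lt_of_le (show p.2 < r from hk) h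
  · exact le_trans (show q.2.1 ≤ r from hk) h

section Span

variable [MeasurableSpace E] {ξ : Ω → E} {Y : Fin K → ℕ → Ω → ℝ} {Z : Fin K → ℕ → ℕ → Ω → ℝ}

lemma sourceSpan_mono {S T : Set (Unit ⊕ (Fin K × ℕ) ⊕ (Fin K × ℕ × ℕ))} (h : S ⊆ T) :
    sourceSpan ξ Y Z S ≤ sourceSpan ξ Y Z T :=
  biSup_mono fun _ hk => h hk

lemma sources_le_sourceSpan {S : Set (Unit ⊕ (Fin K × ℕ) ⊕ (Fin K × ℕ × ℕ))}
    {k : Unit ⊕ (Fin K × ℕ) ⊕ (Fin K × ℕ × ℕ)} (hk : k ∈ S) :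
    sources ξ Y Z k ≤ sourceSpan ξ Y Z S :=
  le_biSup (sources ξ Y Z) hk

lemma info_le_sourceSpan (t : ℕ) : info ξ Y Z t ≤ sourceSpan ξ Y Z (infoIndex t) := by
  refine sup_le (sup_le ?_ ?_) ?_
  · exact sources_le_sourceSpan (k := .inl ()) trivial
  · refine iSup_le fun i => iSup_le fun r => iSup_le fun hr => ?_
    exact sources_le_sourceSpan (k := .inr (.inl (i, r))) hr
  · refine iSup_le fun i => iSup_le fun r => iSup_le fun hr => iSup_le fun l => ?_
    exact sources_le_sourceSpan (k := .inr (.inr (i, r, l))) hr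

lemma measurable_reward_sourceSpan {S : Set (Unit ⊕ (Fin K × ℕ) ⊕ (Fin K × ℕ × ℕ))}
    {i : Fin K} {r : ℕ} (h : .inr (.inl (i, r)) ∈ S) : Measurable[sourceSpan ξ Y Z S] (Y i r) :=
  Measurable.mono (comap_measurable (Y i r)) (sources_le_sourceSpan h) le_rfl

lemma measurable_pseudo_sourceSpan {S : Set (Unit ⊕ (Fin K × ℕ) ⊕ (Fin K × ℕ × ℕ))}
    {i : Fin K} {r l : ℕ} (h : .inr (.inr (i, r, l)) ∈ S) :
    Measurable[sourceSpan ξ Y Z S] (Z i r l) :=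
  Measurable.mono (comap_measurable (Z i r l)) (sources_le_sourceSpan h) le_rfl

end Span

section Measurability

variable [MeasurableSpace Ω] {I : ℕ → Ω → Fin K} {Y : Fin K → ℕ → Ω → ℝ}
  {Z : Fin K → ℕ → ℕ → Ω → ℝ} {t : ℕ}

lemma measurable_pulls (hI : ∀ r < t, Measurable (I r)) (i : Fin K) :
    Measurable (pulls I i t) := by
  refine Finset.measurable_fun_sum _ fun r hr => ?_
  exact Measurable.ite (hI r (Finset.mem_range.1 hr) (measurableSet_singleton i))
    measurable_const measurable_const

lemma measurable_cumReward (hI : ∀ r < t, Measurable (I r)) {i : Fin K}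
    (hY : ∀ r < t, Measurable (Y i r)) : Measurable (cumReward I Y i t) := by
  refine Finset.measurable_fun_sum _ fun r hr => ?_
  exact Measurable.ite (hI r (Finset.mem_range.1 hr) (measurableSet_singleton i))
    (hY r (Finset.mem_range.1 hr)) measurable_const

lemma measurable_estimate (a : ℕ) (hI : ∀ r < t, Measurable (I r)) {i : Fin K}
    (hY : ∀ r < t, Measurable (Y i r)) (hZ : ∀ l, Measurable (Z i t l)) :
    Measurable (estimate a I Y Z i t) := by
  have hp := measurable_pulls hI i
  have hsum : Measurable fun ω => ∑ l ∈ Finset.range (a * pulls I i t ω), Z i t l ω := by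
    have : Measurable fun p : ℕ × Ω => ∑ l ∈ Finset.range (a * p.1), Z i t l p.2 :=
      measurable_from_prod_countable_right fun N =>
        show Measurable fun ω => ∑ l ∈ Finset.range (a * N), Z i t l ω from
          Finset.measurable_fun_sum _ fun l _ => hZ l
    exact this.comp (hp.prodMk measurable_id)
  have hpr : Measurable fun ω => (pulls I i t ω : ℝ) := measurable_from_top.comp hp
  refine Measurable.ite (measurableSet_lt measurable_const hp) ?_ measurable_const
  exact measurable_coe_real_ereal.comp
    (((measurable_cumReward hI hY).add hsum).div (hpr.const_mul _))

end Measurability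

namespace IsRun

variable [MeasurableSpace Ω] [MeasurableSpace E] {P : Measure Ω} {B : Bandit K} {a : ℕ}
  {ξ : Ω → E} {Y : Fin K → ℕ → Ω → ℝ} {Z : Fin K → ℕ → ℕ → Ω → ℝ} {I : ℕ → Ω → Fin K}

lemma sources_le (h : IsRun P B a ξ Y Z I) (k : Unit ⊕ (Fin K × ℕ) ⊕ (Fin K × ℕ × ℕ)) :
    sources ξ Y Z k ≤ ‹MeasurableSpace Ω› := by
  rcases k with k | p | q
  · exact h.measurable_seed.comap_le
  · exact (h.measurable_reward _ _).comap_le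
  · exact (h.measurable_pseudo _ _ _).comap_le

lemma sourceSpan_le (h : IsRun P B a ξ Y Z I)
    (S : Set (Unit ⊕ (Fin K × ℕ) ⊕ (Fin K × ℕ × ℕ))) :
    sourceSpan ξ Y Z S ≤ ‹MeasurableSpace Ω› :=
  iSup₂_le fun k _ => h.sources_le k

lemma indep_sourceSpan (h : IsRun P B a ξ Y Z I)
    {S T : Set (Unit ⊕ (Fin K × ℕ) ⊕ (Fin K × ℕ × ℕ))} (hST : Disjoint S T) :
    Indep (sourceSpan ξ Y Z S) (sourceSpan ξ Y Z T) P :=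
  indep_iSup_of_disjoint h.sources_le h.indep hST

lemma measurable_arm_infoIndex (h : IsRun P B a ξ Y Z I) (t : ℕ) :
    Measurable[sourceSpan ξ Y Z (infoIndex t)] (I t) :=
  (h.nonanticipating t).mono (info_le_sourceSpan t) le_rfl

lemma measurable_arm (h : IsRun P B a ξ Y Z I) (t : ℕ) : Measurable (I t) :=
  (h.measurable_arm_infoIndex t).mono (h.sourceSpan_le _) le_rfl

lemma measurable_arm_othersIndex (h : IsRun P B a ξ Y Z I) (i : Fin K) {r t : ℕ} (hr : r < t) :
    Measurable[sourceSpan ξ Y Z (othersIndex i t)] (I r) :=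
  (h.measurable_arm_infoIndex r).mono (sourceSpan_mono (infoIndex_subset_othersIndex hr i)) le_rfl

lemma measurable_pulls (h : IsRun P B a ξ Y Z I) (i : Fin K) (t : ℕ) :
    Measurable (pulls I i t) :=
  PHE.measurable_pulls (fun r _ => h.measurable_arm r) i

lemma measurable_cumReward (h : IsRun P B a ξ Y Z I) (i : Fin K) (t : ℕ) :
    Measurable (cumReward I Y i t) :=
  PHE.measurable_cumReward (fun r _ => h.measurable_arm r) fun r _ => h.measurable_reward i r

/-- The reward of round `t` is independent of what determines the choice in that round. -/
lemma indep_reward (h : IsRun P B a ξ Y Z I) (i : Fin K) (t : ℕ) :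
    Indep (sourceSpan ξ Y Z (infoIndex t)) (MeasurableSpace.comap (Y i t) inferInstance) P := by
  have hd : Disjoint (infoIndex t) {(.inr (.inl (i, t)) : Unit ⊕ (Fin K × ℕ) ⊕ _)} := by
    rw [Set.disjoint_singleton_right]
    exact lt_irrefl t
  exact indep_of_indep_of_le_right (h.indep_sourceSpan hd)
    (sources_le_sourceSpan (k := .inr (.inl (i, t))) rfl)

/-- The pseudo-rewards of arm `i` in round `t` are independent of the history and of the estimates
of the other arms. -/
lemma indep_pseudo (h : IsRun P B a ξ Y Z I) (i : Fin K) (t m : ℕ) :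
    Indep (sourceSpan ξ Y Z (othersIndex i t))
      (MeasurableSpace.comap (fun ω => ∑ l ∈ Finset.range m, Z i t l ω) inferInstance) P := by
  have hd : Disjoint (othersIndex i t)
      (Set.range fun l : ℕ => (.inr (.inr (i, t, l)) : Unit ⊕ (Fin K × ℕ) ⊕ _)) := by
    rw [Set.disjoint_right]
    rintro _ ⟨l, rfl⟩ hk
    rcases (hk : t < t ∨ (t = t ∧ i ≠ i)) with h1 | h1
    · exact lt_irrefl t h1
    · exact h1.2 rfl
  refine indep_of_indep_of_le_right (h.indep_sourceSpan hd) (Measurable.comap_le ?_)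
  exact Finset.measurable_fun_sum _ fun l _ => measurable_pseudo_sourceSpan ⟨l, rfl⟩

lemma map_sum_pseudo [IsProbabilityMeasure P] (h : IsRun P B a ξ Y Z I) (i : Fin K) (t m : ℕ) :
    P.map (fun ω => ∑ l ∈ Finset.range m, Z i t l ω) = sumLaw fairCoin m := by
  induction m with
  | zero => simp [sumLaw]
  | succ m ih =>
    have hd : Disjoint ((fun l : ℕ => (.inr (.inr (i, t, l)) : Unit ⊕ (Fin K × ℕ) ⊕ _)) ''
        Set.Iio m) {.inr (.inr (i, t, m))} := by
      rw [Set.disjoint_singleton_right]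
      rintro ⟨l, hl, hk⟩
      simp only [Sum.inr.injEq, Prod.mk.injEq, true_and] at hk
      exact absurd hl (by simp [hk])
    have hI : IndepFun (fun ω => ∑ l ∈ Finset.range m, Z i t l ω) (Z i t m) P := by
      refine indep_of_indep_of_le_right (indep_of_indep_of_le_left (h.indep_sourceSpan hd)
        (Measurable.comap_le ?_)) (sources_le_sourceSpan (k := .inr (.inr (i, t, m))) rfl)
      exact Finset.measurable_fun_sum _ fun l hl =>
        measurable_pseudo_sourceSpan ⟨l, Finset.mem_range.1 hl, rfl⟩
    have hsum : (fun ω => ∑ l ∈ Finset.range (m + 1), Z i t l ω) =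
        (fun ω => ∑ l ∈ Finset.range m, Z i t l ω) + Z i t m := by
      funext ω; simp [Finset.sum_range_succ]
    rw [hsum, hI.map_add_eq_map_conv_map₀
      (Finset.measurable_fun_sum _ fun l _ => h.measurable_pseudo i t l).aemeasurable
      (h.measurable_pseudo i t m).aemeasurable, ih, h.pseudo_law, sumLaw]

end IsRun

/-! ### The law of the cumulative reward at a given number of pulls -/

section Pulls

variable {I : ℕ → Ω → Fin K} {Y : Fin K → ℕ → Ω → ℝ} {i : Fin K} {ω : Ω}

lemma pulls_succ (t : ℕ) :
    pulls I i (t + 1) ω = pulls I i t ω + if I t ω = i then 1 else 0 :=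
  Finset.sum_range_succ _ _

lemma cumReward_succ (t : ℕ) :
    cumReward I Y i (t + 1) ω = cumReward I Y i t ω + if I t ω = i then Y i t ω else 0 :=
  Finset.sum_range_succ _ _

lemma pulls_mono : Monotone fun t => pulls I i t ω :=
  monotone_nat_of_le_succ fun t => by rw [pulls_succ]; exact Nat.le_add_right _ _

lemma pulls_le (t : ℕ) : pulls I i t ω ≤ t := by
  induction t with
  | zero => simp [pulls]
  | succ t ih => rw [pulls_succ]; split_ifs <;> omega

/-- Each pull of an arm happens at a different pull count. -/
lemma pulls_ne_of_lt {t t' : ℕ} (h : t < t') (hI : I t ω = i) :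
    pulls I i t ω ≠ pulls I i t' ω := by
  have h1 : pulls I i (t + 1) ω ≤ pulls I i t' ω := pulls_mono (Nat.succ_le_of_lt h)
  rw [pulls_succ, if_pos hI] at h1
  omega

lemma cumReward_eq_zero {t : ℕ} (h : pulls I i t ω = 0) : cumReward I Y i t ω = 0 := by
  induction t with
  | zero => simp [cumReward]
  | succ t ih =>
    rw [pulls_succ] at h
    have hI : I t ω ≠ i := fun hI => by simp [hI] at h
    rw [cumReward_succ, if_neg hI, ih (by omega), add_zero]

lemma exists_last_pull {t s : ℕ} (h : pulls I i t ω = s + 1) :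
    ∃ r < t, I r ω = i ∧ pulls I i r ω = s ∧
      cumReward I Y i t ω = cumReward I Y i r ω + Y i r ω := by
  induction t with
  | zero => simp [pulls] at h
  | succ t ih =>
    rw [pulls_succ] at h
    by_cases hI : I t ω = i
    · rw [if_pos hI] at h
      exact ⟨t, Nat.lt_succ_self t, hI, by omega, by rw [cumReward_succ, if_pos hI]⟩
    · rw [if_neg hI] at h
      obtain ⟨r, hr, h1, h2, h3⟩ := ih h
      exact ⟨r, by omega, h1, h2, by rw [cumReward_succ, if_neg hI, add_zero, h3]⟩

/-- Comparing an estimate with a threshold `θ / (a + 1)`, on the scale of sums. -/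
lemma le_estimate_iff {a : ℕ} {Z : Fin K → ℕ → ℕ → Ω → ℝ} {t s : ℕ}
    (hs : pulls I i t ω = s) (hs0 : 0 < s) (θ : ℝ) :
    ((θ / (a + 1) : ℝ) : EReal) ≤ estimate a I Y Z i t ω ↔
      θ * s ≤ cumReward I Y i t ω + ∑ l ∈ Finset.range (a * s), Z i t l ω := by
  have hs' : (0 : ℝ) < s := by exact_mod_cast hs0
  rw [estimate, hs, if_pos hs0, EReal.coe_le_coe_iff, div_le_div_iff₀ (by positivity)
    (by positivity)]
  constructor
  · intro h1
    refine le_of_mul_le_mul_right (a := (a : ℝ) + 1) ?_ (by positivity)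
    linarith
  · intro h1
    have := mul_le_mul_of_nonneg_right h1 (by positivity : (0 : ℝ) ≤ a + 1)
    linarith

end Pulls

/-- The law of the cumulative reward of arm `i` when it is pulled after `s` earlier pulls, on the
event that this happens in the first `n` rounds (so that the total mass may be less than one). -/
noncomputable def pullLaw [MeasurableSpace Ω] (P : Measure Ω) (I : ℕ → Ω → Fin K)
    (Y : Fin K → ℕ → Ω → ℝ) (i : Fin K) (s n : ℕ) : Measure ℝ :=
  ∑ t ∈ Finset.range n, (P.restrict {ω | I t ω = i ∧ pulls I i t ω = s}).map (cumReward I Y i t)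

lemma measurable_indicator_one {m : MeasurableSpace Ω} {A : Set Ω} (hA : MeasurableSet A) :
    Measurable (A.indicator (1 : Ω → ENNReal)) :=
  measurable_one.indicator hA

lemma measure_inter_eq_lintegral [MeasurableSpace Ω] {P : Measure Ω} {A : Set Ω} {X : Ω → ℝ}
    {S : Set ℝ} (hA : MeasurableSet A) (hX : Measurable X) (hS : MeasurableSet S) :
    P (A ∩ {ω | X ω ∈ S}) = ∫⁻ ω, A.indicator 1 ω * S.indicator 1 (X ω) ∂P := by
  have hXS : MeasurableSet {ω | X ω ∈ S} := hX hS
  rw [← lintegral_indicator_one (hA.inter hXS)]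
  refine lintegral_congr fun ω => ?_
  have hmem : ω ∈ A ∩ {ω | X ω ∈ S} ↔ ω ∈ A ∧ X ω ∈ S := Iff.rfl
  by_cases h1 : ω ∈ A <;> by_cases h2 : X ω ∈ S <;> simp [hmem, h1, h2]

namespace IsRun

variable [MeasurableSpace Ω] [MeasurableSpace E] {P : Measure Ω} {B : Bandit K} {a : ℕ}
  {ξ : Ω → E} {Y : Fin K → ℕ → Ω → ℝ} {Z : Fin K → ℕ → ℕ → Ω → ℝ} {I : ℕ → Ω → Fin K}

lemma measurableSet_pulled (h : IsRun P B a ξ Y Z I) (i : Fin K) (s t : ℕ) :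
    MeasurableSet {ω | I t ω = i ∧ pulls I i t ω = s} :=
  (h.measurable_arm t (measurableSet_singleton i)).inter
    (h.measurable_pulls i t (measurableSet_singleton s))

lemma lintegral_pullLaw (h : IsRun P B a ξ Y Z I) (i : Fin K) (s n : ℕ) {g : ℝ → ENNReal}
    (hg : Measurable g) :
    ∫⁻ v, g v ∂(pullLaw P I Y i s n) = ∑ t ∈ Finset.range n,
      ∫⁻ ω, {ω | I t ω = i ∧ pulls I i t ω = s}.indicator 1 ω * g (cumReward I Y i t ω) ∂P := by
  rw [pullLaw, lintegral_finsetSum_measure]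
  refine Finset.sum_congr rfl fun t _ => ?_
  rw [lintegral_map hg (h.measurable_cumReward i t),
    ← lintegral_indicator (h.measurableSet_pulled i s t)]
  refine lintegral_congr fun ω => ?_
  by_cases hω : ω ∈ {ω | I t ω = i ∧ pulls I i t ω = s}
  · rw [Set.indicator_of_mem hω, Set.indicator_of_mem hω, Pi.one_apply, one_mul]
  · rw [Set.indicator_of_notMem hω, Set.indicator_of_notMem hω, zero_mul]

lemma pullLaw_apply_le (h : IsRun P B a ξ Y Z I) (i : Fin K) (s n : ℕ) {S : Set ℝ}
    (hS : MeasurableSet S) :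
    pullLaw P I Y i s n S ≤
      P {ω | ∃ t < n, pulls I i t ω = s ∧ cumReward I Y i t ω ∈ S} := by
  have h1 : pullLaw P I Y i s n S = ∑ t ∈ Finset.range n,
      P (cumReward I Y i t ⁻¹' S ∩ {ω | I t ω = i ∧ pulls I i t ω = s}) := by
    rw [pullLaw, Measure.finsetSum_apply]
    refine Finset.sum_congr rfl fun t _ => ?_
    rw [Measure.map_apply (h.measurable_cumReward i t) hS,
      Measure.restrict_apply (h.measurable_cumReward i t hS)]
  rw [h1, ← measure_biUnion_finset]
  · refine measure_mono ?_
    intro ω hω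
    simp only [Set.mem_iUnion, Finset.mem_range] at hω
    obtain ⟨t, ht, hS', _, hp⟩ := hω
    exact ⟨t, ht, hp, hS'⟩
  · intro t _ t' _ htt'
    refine Set.disjoint_left.2 fun ω hω hω' => ?_
    rcases lt_or_gt_of_ne htt' with hlt | hlt
    · exact pulls_ne_of_lt hlt hω.2.1 (hω.2.2.trans hω'.2.2.symm)
    · exact pulls_ne_of_lt hlt hω'.2.1 (hω'.2.2.trans hω.2.2.symm)
  · exact fun t _ => (h.measurable_cumReward i t hS).inter (h.measurableSet_pulled i s t)

lemma pullLaw_apply_eq (h : IsRun P B a ξ Y Z I) (i : Fin K) (s n : ℕ) {S : Set ℝ}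
    (hS : MeasurableSet S) :
    pullLaw P I Y i s n S = ∑ t ∈ Finset.range n,
      P {ω | I t ω = i ∧ pulls I i t ω = s ∧ cumReward I Y i t ω ∈ S} := by
  rw [pullLaw, Measure.finsetSum_apply]
  refine Finset.sum_congr rfl fun t _ => ?_
  rw [Measure.map_apply (h.measurable_cumReward i t) hS,
    Measure.restrict_apply (h.measurable_cumReward i t hS)]
  congr 1
  ext ω
  simp only [Set.mem_inter_iff, Set.mem_preimage, Set.mem_ofPred_eq]
  tauto

lemma measurableSet_pulls_others (h : IsRun P B a ξ Y Z I) (i j : Fin K) (s t : ℕ) :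
    MeasurableSet[sourceSpan ξ Y Z (othersIndex i t)] {ω | pulls I j t ω = s} :=
  @PHE.measurable_pulls K Ω (sourceSpan ξ Y Z (othersIndex i t)) I t
    (fun _ hr => h.measurable_arm_othersIndex i hr) j _ (measurableSet_singleton s)

lemma measurable_cumReward_others (h : IsRun P B a ξ Y Z I) (i j : Fin K) (t : ℕ) :
    Measurable[sourceSpan ξ Y Z (othersIndex i t)] (cumReward I Y j t) :=
  @PHE.measurable_cumReward K Ω (sourceSpan ξ Y Z (othersIndex i t)) I Y t
    (fun _ hr => h.measurable_arm_othersIndex i hr) j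
      fun _ hr => measurable_reward_sourceSpan hr

lemma measurable_estimate_others (h : IsRun P B a ξ Y Z I) {i j : Fin K} (hj : j ≠ i) (t : ℕ) :
    Measurable[sourceSpan ξ Y Z (othersIndex i t)] (estimate a I Y Z j t) :=
  @PHE.measurable_estimate K Ω (sourceSpan ξ Y Z (othersIndex i t)) I Y Z t a
    (fun _ hr => h.measurable_arm_othersIndex i hr) j
      (fun _ hr => measurable_reward_sourceSpan hr)
      fun _ => measurable_pseudo_sourceSpan (Or.inr ⟨rfl, hj⟩)

variable [IsProbabilityMeasure P]

/-- Sampling adaptively cannot make any set of cumulative rewards more likely than it is for a sum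
of `s` independent rewards: whether the next pull happens is decided before its reward is drawn. -/
lemma measure_exists_pulls_le (h : IsRun P B a ξ Y Z I) (i : Fin K) (s n : ℕ) {S : Set ℝ}
    (hS : MeasurableSet S) :
    P {ω | ∃ t < n, pulls I i t ω = s ∧ cumReward I Y i t ω ∈ S} ≤ sumLaw (B.law i) s S := by
  have := B.isProb i
  induction s generalizing S with
  | zero =>
    by_cases h0 : (0 : ℝ) ∈ S
    · rw [sumLaw, Measure.dirac_apply_of_mem h0]
      exact prob_le_one
    · refine (measure_mono (t := ∅) ?_).trans (by simp)
      rintro ω ⟨t, _, hp, hV⟩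
      rw [cumReward_eq_zero hp] at hV
      exact h0 hV
  | succ s ih =>
    have hle : pullLaw P I Y i s n ≤ sumLaw (B.law i) s := by
      rw [Measure.le_iff]
      exact fun T hT => (h.pullLaw_apply_le i s n hT).trans (ih hT)
    have hmeas : Measurable fun v : ℝ => B.law i ((fun y => v + y) ⁻¹' S) :=
      measurable_measure_prodMk_left (ν := B.law i) (s := {p : ℝ × ℝ | p.1 + p.2 ∈ S})
        (measurable_add hS)
    calc P {ω | ∃ t < n, pulls I i t ω = s + 1 ∧ cumReward I Y i t ω ∈ S}
        ≤ P (⋃ r ∈ Finset.range n, {ω | I r ω = i ∧ pulls I i r ω = s} ∩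
            {ω | cumReward I Y i r ω + Y i r ω ∈ S}) := by
          refine measure_mono ?_
          rintro ω ⟨t, ht, hp, hV⟩
          obtain ⟨r, hr, h1, h2, h3⟩ := exists_last_pull (Y := Y) hp
          simp only [Set.mem_iUnion, Finset.mem_range]
          refine ⟨r, hr.trans ht, ⟨h1, h2⟩, ?_⟩
          rw [Set.mem_ofPred_eq, ← h3]
          exact hV
      _ ≤ ∑ r ∈ Finset.range n, P ({ω | I r ω = i ∧ pulls I i r ω = s} ∩
            {ω | cumReward I Y i r ω + Y i r ω ∈ S}) := measure_biUnion_finset_le _ _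
      _ = ∑ r ∈ Finset.range n, ∫⁻ ω, {ω | I r ω = i ∧ pulls I i r ω = s}.indicator 1 ω *
            B.law i ((fun y => cumReward I Y i r ω + y) ⁻¹' S) ∂P := by
          refine Finset.sum_congr rfl fun r _ => ?_
          have hmI : ∀ r' < r, Measurable[sourceSpan ξ Y Z (infoIndex r)] (I r') := fun r' hr' =>
            (h.measurable_arm_infoIndex r').mono (sourceSpan_mono (infoIndex_mono hr'.le)) le_rfl
          have hA : MeasurableSet[sourceSpan ξ Y Z (infoIndex r)]
              {ω | I r ω = i ∧ pulls I i r ω = s} :=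
            MeasurableSet.inter (h.measurable_arm_infoIndex r (measurableSet_singleton i))
              (@PHE.measurable_pulls K Ω (sourceSpan ξ Y Z (infoIndex r)) I r hmI i _
                (measurableSet_singleton s))
          have hV : Measurable[sourceSpan ξ Y Z (infoIndex r)] (cumReward I Y i r) :=
            @PHE.measurable_cumReward K Ω (sourceSpan ξ Y Z (infoIndex r)) I Y r hmI i
              fun r' hr' => measurable_reward_sourceSpan hr'
          have hkey := lintegral_mul_indicator_add (P := P) (h.sourceSpan_le (infoIndex r))
            (w := {ω | I r ω = i ∧ pulls I i r ω = s}.indicator 1)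
            (measurable_indicator_one hA) hV
            (h.measurable_reward i r) (h.indep_reward i r) hS
          rw [h.reward_law] at hkey
          rw [← hkey]
          exact measure_inter_eq_lintegral (h.measurableSet_pulled i s r)
            ((h.measurable_cumReward i r).add (h.measurable_reward i r)) hS
      _ = ∫⁻ v, B.law i ((fun y => v + y) ⁻¹' S) ∂(pullLaw P I Y i s n) :=
          (h.lintegral_pullLaw i s n hmeas).symm
      _ ≤ ∫⁻ v, B.law i ((fun y => v + y) ⁻¹' S) ∂(sumLaw (B.law i) s) :=
          lintegral_mono' hle le_rfl
      _ = sumLaw (B.law i) (s + 1) S := (sumLaw_succ_apply _ _ hS).symm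

lemma pullLaw_le (h : IsRun P B a ξ Y Z I) (i : Fin K) (s n : ℕ) :
    pullLaw P I Y i s n ≤ sumLaw (B.law i) s := by
  rw [Measure.le_iff]
  exact fun T hT => (h.pullLaw_apply_le i s n hT).trans (h.measure_exists_pulls_le i s n hT)

/-- Averaging over the pseudo-rewards of arm `i` in round `t`, with everything else fixed, the
perturbed sum reaches the threshold `r` with probability `coinTail m (r - V)`. -/
lemma lintegral_mul_Ici (h : IsRun P B a ξ Y Z I) (i : Fin K) (t m : ℕ) (r : ℝ)
    {w : Ω → ENNReal} (hw : Measurable[sourceSpan ξ Y Z (othersIndex i t)] w) :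
    ∫⁻ ω, w ω * (Set.Ici r).indicator 1
        (cumReward I Y i t ω + ∑ l ∈ Finset.range m, Z i t l ω) ∂P =
      ∫⁻ ω, w ω * ENNReal.ofReal (coinTail m (r - cumReward I Y i t ω)) ∂P := by
  rw [lintegral_mul_indicator_add (h.sourceSpan_le _) hw (h.measurable_cumReward_others i i t)
    (Finset.measurable_fun_sum _ fun l _ => h.measurable_pseudo i t l) (h.indep_pseudo i t m)
    measurableSet_Ici]
  refine lintegral_congr fun ω => ?_
  rw [h.map_sum_pseudo, ← sumLaw_fairCoin_Ici]
  congr 2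
  ext y
  simp [add_comm]

lemma lintegral_mul_Iio (h : IsRun P B a ξ Y Z I) (i : Fin K) (t m : ℕ) (r : ℝ)
    {w : Ω → ENNReal} (hw : Measurable[sourceSpan ξ Y Z (othersIndex i t)] w) :
    ∫⁻ ω, w ω * (Set.Iio r).indicator 1
        (cumReward I Y i t ω + ∑ l ∈ Finset.range m, Z i t l ω) ∂P =
      ∫⁻ ω, w ω * ENNReal.ofReal (1 - coinTail m (r - cumReward I Y i t ω)) ∂P := by
  have hc : IsProbabilityMeasure fairCoin := by unfold fairCoin; infer_instance
  rw [lintegral_mul_indicator_add (h.sourceSpan_le _) hw (h.measurable_cumReward_others i i t)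
    (Finset.measurable_fun_sum _ fun l _ => h.measurable_pseudo i t l) (h.indep_pseudo i t m)
    measurableSet_Iio]
  refine lintegral_congr fun ω => ?_
  have hset : (fun y => cumReward I Y i t ω + y) ⁻¹' Set.Iio r =
      (Set.Ici (r - cumReward I Y i t ω))ᶜ := by
    ext y
    simp [lt_sub_iff_add_lt, add_comm]
  rw [h.map_sum_pseudo, hset, prob_compl_eq_one_sub measurableSet_Ici, sumLaw_fairCoin_Ici,
    ENNReal.ofReal_sub _ (coinTail_nonneg _ _), ENNReal.ofReal_one]

end IsRun

/-! ### Counting the pulls of a suboptimal arm -/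

namespace IsRun

variable [MeasurableSpace Ω] [MeasurableSpace E] {P : Measure Ω} {B : Bandit K} {a : ℕ}
  {ξ : Ω → E} {Y : Fin K → ℕ → Ω → ℝ} {Z : Fin K → ℕ → ℕ → Ω → ℝ} {I : ℕ → Ω → Fin K}

lemma measurable_cumReward_add_sum (h : IsRun P B a ξ Y Z I) (i : Fin K) (t m : ℕ) :
    Measurable fun ω => cumReward I Y i t ω + ∑ l ∈ Finset.range m, Z i t l ω :=
  (h.measurable_cumReward i t).add
    (Finset.measurable_fun_sum _ fun l _ => h.measurable_pseudo i t l)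

lemma measurableSet_pulls_cumReward (h : IsRun P B a ξ Y Z I) (i : Fin K) (s t : ℕ) {S : Set ℝ}
    (hS : MeasurableSet S) :
    MeasurableSet[sourceSpan ξ Y Z (othersIndex i t)]
      {ω | pulls I i t ω = s ∧ cumReward I Y i t ω ∈ S} :=
  MeasurableSet.inter (h.measurableSet_pulls_others i i s t)
    (h.measurable_cumReward_others i i t hS)

variable [IsProbabilityMeasure P]

lemma sum_measure_pulls_cumReward_le (h : IsRun P B a ξ Y Z I) (i : Fin K) (s n : ℕ) {S : Set ℝ}
    (hS : MeasurableSet S) :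
    ∑ t ∈ Finset.range n, P {ω | pulls I i t ω = s ∧ cumReward I Y i t ω ∈ S} ≤
      n * sumLaw (B.law i) s S := by
  calc _ ≤ ∑ _t ∈ Finset.range n, sumLaw (B.law i) s S := by
        refine Finset.sum_le_sum fun t ht => ?_
        refine (measure_mono ?_).trans (h.measure_exists_pulls_le i s n hS)
        exact fun ω hω => ⟨t, Finset.mem_range.1 ht, hω.1, hω.2⟩
    _ = _ := by simp

/-- The pulls of arm `i` at pull count `s` in which its estimate reaches the threshold: either its
cumulative reward exceeds `β`, or the pseudo-rewards lift it over the threshold. -/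
lemma sum_measure_le_estimate_le (h : IsRun P B a ξ Y Z I) (i : Fin K) {s : ℕ} (hs : 0 < s)
    (n : ℕ) {θ β e : ℝ} (hq : ∀ v ≤ β, coinTail (a * s) (θ * s - v) ≤ e) :
    ∑ t ∈ Finset.range n, P {ω | I t ω = i ∧ pulls I i t ω = s ∧
        ((θ / (a + 1) : ℝ) : EReal) ≤ estimate a I Y Z i t ω} ≤
      sumLaw (B.law i) s (Set.Ioi β) +
        ENNReal.ofReal e * ∑ t ∈ Finset.range n, P {ω | pulls I i t ω = s} := by
  refine le_trans ?_ (add_le_add_left (h.pullLaw_le i s n (Set.Ioi β)) _)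
  rw [h.pullLaw_apply_eq i s n measurableSet_Ioi, Finset.mul_sum, ← Finset.sum_add_distrib]
  refine Finset.sum_le_sum fun t _ => ?_
  set A : Set Ω := {ω | pulls I i t ω = s ∧ cumReward I Y i t ω ∈ Set.Iic β} with hA
  have hAm : MeasurableSet[sourceSpan ξ Y Z (othersIndex i t)] A :=
    h.measurableSet_pulls_cumReward i s t (measurableSet_Iic (a := β))
  have hpm : MeasurableSet {ω | pulls I i t ω = s} :=
    h.measurable_pulls i t (measurableSet_singleton s)
  have hlift : P (A ∩ {ω | cumReward I Y i t ω + ∑ l ∈ Finset.range (a * s), Z i t l ω ∈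
      Set.Ici (θ * s)}) ≤ ENNReal.ofReal e * P {ω | pulls I i t ω = s} := by
    rw [measure_inter_eq_lintegral (h.sourceSpan_le _ _ hAm) (h.measurable_cumReward_add_sum i t _)
      measurableSet_Ici,
      h.lintegral_mul_Ici i t (a * s) (θ * s) (measurable_indicator_one hAm),
      ← lintegral_indicator_one hpm, ← lintegral_const_mul _ (measurable_one.indicator hpm)]
    refine lintegral_mono fun ω => ?_
    by_cases hω : ω ∈ A
    · have hω' : ω ∈ {ω | pulls I i t ω = s} := hω.1
      rw [Set.indicator_of_mem hω, Set.indicator_of_mem hω', Pi.one_apply, one_mul, mul_one]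
      exact ENNReal.ofReal_le_ofReal (hq _ hω.2)
    · rw [Set.indicator_of_notMem hω, zero_mul]
      exact zero_le
  refine le_trans (measure_mono ?_) ((measure_union_le _ _).trans (add_le_add_right hlift _))
  rintro ω ⟨hI, hp, hest⟩
  rw [le_estimate_iff hp hs] at hest
  rcases lt_or_ge β (cumReward I Y i t ω) with hβ | hβ
  · exact Or.inl ⟨hI, hp, hβ⟩
  · exact Or.inr ⟨⟨hp, hβ⟩, hest⟩

/-- The rounds at pull count `s` of arm `i` in which all estimates stay below the threshold.
Given the history and the estimates of the other arms, such a round is `1 / q - 1` times as likely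
as one where only arm `i` reaches the threshold and hence is pulled; here `q` is the probability
that arm `i` reaches it. -/
lemma sum_measure_estimate_lt_le (h : IsRun P B a ξ Y Z I) (i : Fin K) {s : ℕ} (hs : 0 < s)
    (n : ℕ) {θ : ℝ} {G : Set ℝ} (hG : MeasurableSet G)
    (hq : ∀ v ∈ G, 0 < coinTail (a * s) (θ * s - v)) :
    ∑ t ∈ Finset.range n, P {ω | (pulls I i t ω = s ∧ cumReward I Y i t ω ∈ G) ∧
        ∀ j, estimate a I Y Z j t ω < ((θ / (a + 1) : ℝ) : EReal)} ≤
      ∫⁻ v, G.indicator (fun v => ENNReal.ofReal (1 / coinTail (a * s) (θ * s - v) - 1)) v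
        ∂(sumLaw (B.law i) s) := by
  set g : ℝ → ENNReal :=
    G.indicator (fun v => ENNReal.ofReal (1 / coinTail (a * s) (θ * s - v) - 1)) with hg
  have hcoin : Measurable fun v : ℝ => coinTail (a * s) (θ * s - v) :=
    (coinTail_antitone _).measurable.comp (by fun_prop)
  have hgm : Measurable g :=
    (ENNReal.measurable_ofReal.comp
      ((measurable_const.div hcoin).sub measurable_const)).indicator hG
  refine le_trans ?_ (lintegral_mono' (h.pullLaw_le i s n) le_rfl)
  rw [h.lintegral_pullLaw i s n hgm]
  refine Finset.sum_le_sum fun t _ => ?_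
  set C : Set Ω := {ω | pulls I i t ω = s ∧ cumReward I Y i t ω ∈ G} ∩
    ⋂ j ∈ {j | j ≠ i}, {ω | estimate a I Y Z j t ω < ((θ / (a + 1) : ℝ) : EReal)} with hC
  have hCm : MeasurableSet[sourceSpan ξ Y Z (othersIndex i t)] C := by
    refine MeasurableSet.inter (h.measurableSet_pulls_cumReward i s t hG) ?_
    refine MeasurableSet.biInter (Set.to_countable _) fun j hj => ?_
    exact h.measurable_estimate_others hj t measurableSet_Iio
  have hVm := h.measurable_cumReward_others i i t
  have hmem : ∀ {ω}, ω ∈ C → pulls I i t ω = s ∧ cumReward I Y i t ω ∈ G ∧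
      ∀ j ≠ i, estimate a I Y Z j t ω < ((θ / (a + 1) : ℝ) : EReal) := by
    intro ω hω
    exact ⟨hω.1.1, hω.1.2, fun j hj => Set.mem_iInter₂.1 hω.2 j hj⟩
  calc P {ω | (pulls I i t ω = s ∧ cumReward I Y i t ω ∈ G) ∧
        ∀ j, estimate a I Y Z j t ω < ((θ / (a + 1) : ℝ) : EReal)}
      ≤ P (C ∩ {ω | cumReward I Y i t ω + ∑ l ∈ Finset.range (a * s), Z i t l ω ∈
          Set.Iio (θ * s)}) := by
        refine measure_mono ?_
        rintro ω ⟨hp, hest⟩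
        refine ⟨⟨hp, Set.mem_iInter₂.2 fun j _ => hest j⟩, ?_⟩
        have := hest i
        rw [← not_le, le_estimate_iff hp.1 hs, not_le] at this
        exact this
    _ = ∫⁻ ω, C.indicator 1 ω *
          ENNReal.ofReal (1 - coinTail (a * s) (θ * s - cumReward I Y i t ω)) ∂P := by
        rw [measure_inter_eq_lintegral (h.sourceSpan_le _ _ hCm)
          (h.measurable_cumReward_add_sum i t _) measurableSet_Iio,
          h.lintegral_mul_Iio i t (a * s) (θ * s) (measurable_indicator_one hCm)]
    _ = ∫⁻ ω, (C.indicator 1 ω * g (cumReward I Y i t ω)) *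
          ENNReal.ofReal (coinTail (a * s) (θ * s - cumReward I Y i t ω)) ∂P := by
        refine lintegral_congr fun ω => ?_
        by_cases hω : ω ∈ C
        · have hv := (hmem hω).2.1
          have hq0 := hq _ hv
          have hq1 := coinTail_le_one (a * s) (θ * s - cumReward I Y i t ω)
          rw [Set.indicator_of_mem hω, Pi.one_apply, one_mul, one_mul, hg,
            Set.indicator_of_mem hv, ← ENNReal.ofReal_mul
              (sub_nonneg.2 ((one_le_div hq0).2 hq1)), sub_mul, one_div_mul_cancel hq0.ne', one_mul]
        · rw [Set.indicator_of_notMem hω, zero_mul, zero_mul, zero_mul]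
    _ = ∫⁻ ω, (C.indicator 1 ω * g (cumReward I Y i t ω)) * (Set.Ici (θ * s)).indicator 1
          (cumReward I Y i t ω + ∑ l ∈ Finset.range (a * s), Z i t l ω) ∂P :=
        (h.lintegral_mul_Ici i t (a * s) (θ * s)
          ((measurable_indicator_one hCm).mul (hgm.comp hVm))).symm
    _ ≤ ∫⁻ ω, {ω | I t ω = i ∧ pulls I i t ω = s}.indicator 1 ω *
          g (cumReward I Y i t ω) ∂P := by
        refine lintegral_mono fun ω => ?_
        by_cases hω : ω ∈ C
        swap
        · rw [Set.indicator_of_notMem hω, zero_mul, zero_mul]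
          exact zero_le
        by_cases hZ : cumReward I Y i t ω + ∑ l ∈ Finset.range (a * s), Z i t l ω ∈
            Set.Ici (θ * s)
        swap
        · rw [Set.indicator_of_notMem hZ, mul_zero]
          exact zero_le
        obtain ⟨hp, -, hoth⟩ := hmem hω
        have hI : I t ω = i := by
          by_contra hne
          have h1 := (le_estimate_iff (Y := Y) (Z := Z) (a := a) hp hs θ).2 hZ
          exact absurd ((h1.trans (h.pulls_argmax t ω i)).trans_lt (hoth _ hne)) (lt_irrefl _)
        have hω' : ω ∈ {ω | I t ω = i ∧ pulls I i t ω = s} := ⟨hI, hp⟩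
        rw [Set.indicator_of_mem hω, Set.indicator_of_mem hω', Set.indicator_of_mem hZ]
        simp

end IsRun

lemma exp_neg_le_inv_pow {n k : ℕ} (hn : 0 < n) {y : ℝ} (hy : k * Real.log n ≤ y) :
    Real.exp (-y) ≤ (1 / (n : ℝ)) ^ k := by
  have hn' : (0 : ℝ) < n := by exact_mod_cast hn
  rw [one_div, ← Real.exp_log (inv_pos.2 hn'), ← Real.exp_nat_mul, Real.log_inv, Real.exp_le_exp]
  linarith

namespace Bandit

variable (B : Bandit K)

lemma ae_law_mem_Icc (i : Fin K) : ∀ᵐ y ∂(B.law i), y ∈ Set.Icc (0 : ℝ) 1 :=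
  ae_iff.2 (B.support i)

lemma mean_mem_Icc (i : Fin K) : B.mean i ∈ Set.Icc (0 : ℝ) 1 := by
  have := B.isProb i
  have hint : Integrable (fun y : ℝ => y) (B.law i) :=
    Integrable.of_mem_Icc 0 1 measurable_id.aemeasurable (B.ae_law_mem_Icc i)
  refine ⟨integral_nonneg_of_ae ((B.ae_law_mem_Icc i).mono fun y hy => hy.1), ?_⟩
  have := integral_mono_ae hint (integrable_const (1 : ℝ))
    ((B.ae_law_mem_Icc i).mono fun y hy => hy.2)
  simpa [Bandit.mean] using this

lemma exists_mean_eq (i : Fin K) : ∃ k, B.mean k = B.mean i + B.gap i := by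
  have : Nonempty (Fin K) := ⟨i⟩
  obtain ⟨k, hk⟩ := exists_eq_ciSup_of_finite (f := B.mean)
  exact ⟨k, by rw [hk, Bandit.gap]; ring⟩

lemma gap_le_one (i : Fin K) : B.gap i ≤ 1 := by
  obtain ⟨k, hk⟩ := B.exists_mean_eq i
  have h1 := (B.mean_mem_Icc k).2
  have h2 := (B.mean_mem_Icc i).1
  linarith

end Bandit

/-- The part of Hoeffding's inequality for rewards used for the suboptimal arm. -/
lemma sumLaw_Ioi_le {B : Bandit K} (i : Fin K) {s : ℕ} (hs : 0 < s) {x : ℝ} (hx : 0 ≤ x) :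
    sumLaw (B.law i) s (Set.Ioi ((B.mean i + x) * s)) ≤
      ENNReal.ofReal (Real.exp (-(2 * x ^ 2 * s))) := by
  have := B.isProb i
  have hs' : (0 : ℝ) < s := by exact_mod_cast hs
  refine (measure_mono ?_).trans ((sumLaw_deviation_le (B.law i) (B.ae_law_mem_Icc i) hs
    (x := x * s) (ε := 1) (by positivity) (by norm_num)).trans (le_of_eq ?_))
  · intro v hv
    have hv' : (B.mean i + x) * s < v := hv
    change x * s ≤ 1 * (v - s * B.mean i)
    linarith
  · congr 3
    field_simp

/-- The part of Hoeffding's inequality for rewards used for the optimal arm. -/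
lemma sumLaw_Iio_le {B : Bandit K} (i : Fin K) {s : ℕ} (hs : 0 < s) {x : ℝ} (hx : 0 ≤ x) :
    sumLaw (B.law i) s (Set.Iio ((B.mean i - x) * s)) ≤
      ENNReal.ofReal (Real.exp (-(2 * x ^ 2 * s))) := by
  have := B.isProb i
  have hs' : (0 : ℝ) < s := by exact_mod_cast hs
  refine (measure_mono ?_).trans ((sumLaw_deviation_le (B.law i) (B.ae_law_mem_Icc i) hs
    (x := x * s) (ε := -1) (by positivity) (by norm_num)).trans (le_of_eq ?_))
  · intro v hv
    have hv' : v < (B.mean i - x) * s := hv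
    change x * s ≤ -1 * (v - s * B.mean i)
    linarith
  · congr 3
    field_simp

/-- Sorting rounds by the current pull count of an arm. -/
lemma sum_measure_le_sum_sum [MeasurableSpace Ω] {P : Measure Ω} {I : ℕ → Ω → Fin K}
    (i : Fin K) (n : ℕ) (A : ℕ → Set Ω) :
    ∑ t ∈ Finset.range n, P (A t) ≤ ∑ s ∈ Finset.range n, ∑ t ∈ Finset.range n,
      P (A t ∩ {ω | pulls I i t ω = s}) := by
  rw [Finset.sum_comm]
  refine Finset.sum_le_sum fun t ht => ?_
  refine (measure_mono ?_).trans (measure_biUnion_finset_le _ _)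
  intro ω hω
  simp only [Set.mem_iUnion]
  exact ⟨pulls I i t ω, Finset.mem_range.2 ((pulls_le t).trans_lt (Finset.mem_range.1 ht)), hω, rfl⟩

namespace IsRun

variable [MeasurableSpace Ω] [MeasurableSpace E] {P : Measure Ω} [IsProbabilityMeasure P]
  {B : Bandit K} {a : ℕ} {ξ : Ω → E} {Y : Fin K → ℕ → Ω → ℝ} {Z : Fin K → ℕ → ℕ → Ω → ℝ}
  {I : ℕ → Ω → Fin K}

lemma sum_sum_measure_pulls_le (h : IsRun P B a ξ Y Z I) (i : Fin K) (n : ℕ) :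
    ∑ s ∈ Finset.range n, ∑ t ∈ Finset.range n, P {ω | pulls I i t ω = s} ≤ n := by
  rw [Finset.sum_comm]
  calc _ ≤ ∑ _t ∈ Finset.range n, (1 : ENNReal) := by
        refine Finset.sum_le_sum fun t _ => ?_
        rw [← measure_biUnion_finset]
        · exact prob_le_one
        · intro s _ s' _ hss'
          exact Set.disjoint_left.2 fun ω (hω : _ = s) (hω' : _ = s') => hss' (hω.symm.trans hω')
        · exact fun s _ => h.measurable_pulls i t (measurableSet_singleton s)
    _ = n := by simp

/-- The expected number of pulls of arm `i` in which its estimate reaches the midpoint between its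
own mean and the optimal mean. -/
lemma sum_measure_pull_of_le_estimate_le (h : IsRun P B a ξ Y Z I) (ha : 2 < a) {n : ℕ}
    (hn : 2 ≤ n) (i : Fin K) (hD : 0 < B.gap i) :
    ∑ t ∈ Finset.range n, P {ω | I t ω = i ∧
        (((B.mean i + B.gap i / 2 + a / 2) / (a + 1) : ℝ) : EReal) ≤ estimate a I Y Z i t ω} ≤
      ENNReal.ofReal (8 * a * Real.log n / B.gap i ^ 2 + 3) := by
  set D := B.gap i with hDdef
  set θ : ℝ := B.mean i + D / 2 + a / 2 with hθ
  have hn0 : 0 < n := by omega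
  have hn' : (0 : ℝ) < n := by exact_mod_cast hn0
  have ha' : (2 : ℝ) < a := by exact_mod_cast ha
  have hlog : 0 < Real.log n := Real.log_pos (by exact_mod_cast (by omega : 1 < n))
  set x : ℝ := 8 * a * Real.log n / D ^ 2 with hx
  have hx0 : 0 < x := by positivity
  set S := ⌈x⌉₊ with hS
  have := B.isProb i
  refine (sum_measure_le_sum_sum (I := I) i n _).trans ?_
  have hone : ∀ s ∈ Finset.range n, ∑ t ∈ Finset.range n, P ({ω | I t ω = i ∧
        ((θ / (a + 1) : ℝ) : EReal) ≤ estimate a I Y Z i t ω} ∩ {ω | pulls I i t ω = s}) ≤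
      ((if s < S then 1 else 0) + ENNReal.ofReal (1 / n)) +
        ENNReal.ofReal (1 / n) * ∑ t ∈ Finset.range n, P {ω | pulls I i t ω = s} := by
    intro s _
    by_cases hs : s < S
    · rw [if_pos hs]
      refine le_trans ?_ (le_add_right (le_add_right le_rfl))
      refine le_trans ?_ (prob_le_one (μ := sumLaw (B.law i) s) (s := Set.univ))
      refine le_trans ?_ (h.pullLaw_le i s n Set.univ)
      rw [h.pullLaw_apply_eq i s n MeasurableSet.univ]
      exact Finset.sum_le_sum fun t _ => measure_mono fun ω hω => ⟨hω.1.1, hω.2, trivial⟩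
    · rw [if_neg hs, zero_add]
      have hxs : x ≤ s := (Nat.le_ceil x).trans (by exact_mod_cast not_lt.1 hs)
      have hs' : (0 : ℝ) < s := hx0.trans_le hxs
      have hs0 : 0 < s := by exact_mod_cast hs'
      have hxD : 8 * a * Real.log n ≤ s * D ^ 2 := by
        rwa [hx, div_le_iff₀ (by positivity)] at hxs
      have hcoin : ∀ v ≤ (B.mean i + D / 4) * s, coinTail (a * s) (θ * s - v) ≤ 1 / n := by
        intro v hv
        have hm : 0 < a * s := Nat.mul_pos (by omega) hs0
        have h1 : ((a * s : ℕ) : ℝ) / 2 + s * D / 4 ≤ θ * s - v := by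
          rw [hθ]; push_cast; linarith
        refine (coinTail_antitone _ h1).trans ((coinTail_le_exp hm (by positivity)).trans ?_)
        have h2 := exp_neg_le_inv_pow (k := 1) hn0
          (y := 2 * (s * D / 4) ^ 2 / ((a * s : ℕ) : ℝ)) (by
            rw [le_div_iff₀ (by exact_mod_cast hm)]
            push_cast
            nlinarith)
        simpa using h2
      have htail : sumLaw (B.law i) s (Set.Ioi ((B.mean i + D / 4) * s)) ≤
          ENNReal.ofReal (1 / n) := by
        refine (sumLaw_Ioi_le i hs0 (by positivity)).trans (ENNReal.ofReal_le_ofReal ?_)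
        have h2 := exp_neg_le_inv_pow (k := 1) hn0 (y := 2 * (D / 4) ^ 2 * s) (by
          push_cast
          nlinarith)
        simpa using h2
      refine le_trans ?_ ((h.sum_measure_le_estimate_le i hs0 n hcoin).trans
        (add_le_add_left htail _))
      exact Finset.sum_le_sum fun t _ => measure_mono fun ω hω => ⟨hω.1.1, hω.2, hω.1.2⟩
  refine (Finset.sum_le_sum hone).trans ?_
  rw [Finset.sum_add_distrib, Finset.sum_add_distrib, ← Finset.mul_sum, Finset.sum_boole,
    Finset.sum_const, Finset.card_range, nsmul_eq_mul]
  have hinv : (n : ENNReal) * ENNReal.ofReal (1 / n) = 1 := by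
    rw [← ENNReal.ofReal_natCast, ← ENNReal.ofReal_mul (by positivity), mul_one_div_cancel hn'.ne',
      ENNReal.ofReal_one]
  have hlast : ENNReal.ofReal (1 / n) * ∑ s ∈ Finset.range n, ∑ t ∈ Finset.range n,
      P {ω | pulls I i t ω = s} ≤ 1 := by
    rw [← hinv, mul_comm (n : ENNReal)]
    exact mul_le_mul_right (h.sum_sum_measure_pulls_le i n) _
  have hcard : (((Finset.range n).filter fun s => s < S).card : ENNReal) ≤
      ENNReal.ofReal (x + 1) := by
    have h1 : ((Finset.range n).filter fun s => s < S).card ≤ S := by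
      refine (Finset.card_le_card (t := Finset.range S) fun s hs => ?_).trans
        (Finset.card_range S).le
      exact Finset.mem_range.2 (Finset.mem_filter.1 hs).2
    rw [← ENNReal.ofReal_natCast]
    refine ENNReal.ofReal_le_ofReal ?_
    have h2 : (((Finset.range n).filter fun s => s < S).card : ℝ) ≤ S := by exact_mod_cast h1
    exact h2.trans (Nat.ceil_lt_add_one hx0.le).le
  rw [hinv]
  refine (add_le_add (add_le_add_left hcard 1) hlast).trans (le_of_eq ?_)
  rw [← ENNReal.ofReal_one, ← ENNReal.ofReal_add (by positivity) (by norm_num),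
    ← ENNReal.ofReal_add (by positivity) (by norm_num)]
  congr 1
  ring

/-- The expected number of pulls of arm `i` in which its estimate stays below the midpoint. In such
a round the estimate of an optimal arm `k` stays below it as well. -/
lemma sum_measure_pull_of_estimate_lt_le (h : IsRun P B a ξ Y Z I) (ha : 2 < a) {n : ℕ}
    (hn : 2 ≤ n) (i : Fin K) (hD : 0 < B.gap i) :
    ∑ t ∈ Finset.range n, P {ω | I t ω = i ∧ estimate a I Y Z i t ω <
        (((B.mean i + B.gap i / 2 + a / 2) / (a + 1) : ℝ) : EReal)} ≤
      ENNReal.ofReal (16 * a * boundConst a * Real.log n / B.gap i ^ 2 + 2) := by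
  obtain ⟨k, hk⟩ := B.exists_mean_eq i
  set D := B.gap i with hDdef
  set θ : ℝ := B.mean i + D / 2 + a / 2 with hθ
  have hθ' : θ = B.mean k - D / 2 + a / 2 := by rw [hθ, hk]; ring
  have hn0 : 0 < n := by omega
  have hn' : (0 : ℝ) < n := by exact_mod_cast hn0
  have hn2 : (2 : ℝ) ≤ n := by exact_mod_cast hn
  have ha' : (2 : ℝ) < a := by exact_mod_cast ha
  have hlog : 0 < Real.log n := Real.log_pos (by exact_mod_cast (by omega : 1 < n))
  have hc0 : 0 ≤ boundConst a := by unfold boundConst; positivity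
  set x : ℝ := 16 * a * Real.log n / D ^ 2 with hx
  have hx0 : 0 < x := by positivity
  have := B.isProb k
  obtain ⟨hk0, hk1⟩ := B.mean_mem_Icc k
  set A : ℕ → Set Ω := fun t => {ω | ∀ j, estimate a I Y Z j t ω <
    ((θ / (a + 1) : ℝ) : EReal)} with hA
  have hsub : ∑ t ∈ Finset.range n, P {ω | I t ω = i ∧ estimate a I Y Z i t ω <
      ((θ / (a + 1) : ℝ) : EReal)} ≤ ∑ t ∈ Finset.range n, P (A t) := by
    refine Finset.sum_le_sum fun t _ => measure_mono ?_
    rintro ω ⟨hI, hω⟩ j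
    refine (h.pulls_argmax t ω j).trans_lt ?_
    rwa [hI]
  refine hsub.trans ((sum_measure_le_sum_sum (I := I) k n A).trans ?_)
  have hpow : (1 / (n : ℝ)) ^ 2 ≤ 1 / 4 := by
    rw [div_pow, one_pow]
    exact one_div_le_one_div_of_le (by norm_num) (by nlinarith)
  have hone : ∀ s ∈ Finset.range n, ∑ t ∈ Finset.range n, P (A t ∩ {ω | pulls I k t ω = s}) ≤
      (if s ∈ Finset.Icc 1 ⌊x⌋₊ then ENNReal.ofReal (boundConst a) else 0) +
        ENNReal.ofReal (2 / n) := by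
    intro s _
    rcases Nat.eq_zero_or_pos s with rfl | hs0
    · refine le_trans (le_of_eq ?_) zero_le
      refine Finset.sum_eq_zero fun t _ => ?_
      refine measure_mono_null (t := ∅) ?_ measure_empty
      rintro ω ⟨hω, hp⟩
      have h1 := hω k
      have hp' : pulls I k t ω = 0 := hp
      rw [estimate, hp', if_neg (lt_irrefl 0)] at h1
      exact absurd h1 not_top_lt
    have hs' : (0 : ℝ) < s := by exact_mod_cast hs0
    have hm : 0 < a * s := Nat.mul_pos (by omega) hs0
    have hm' : (0 : ℝ) < ((a * s : ℕ) : ℝ) := by exact_mod_cast hm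
    by_cases hsx : (s : ℝ) ≤ x
    · rw [if_pos (Finset.mem_Icc.2 ⟨hs0, Nat.le_floor hsx⟩)]
      refine le_trans ?_ (le_add_right le_rfl)
      -- Few pulls: outside the null set of negative rewards, the optimal arm reaches the
      -- threshold if all its pseudo-rewards are one.
      have hhalf : ∀ v : ℝ, θ * s - v ≤ ((a * s : ℕ) : ℝ) / 2 + (s * B.mean k - v) := by
        intro v; rw [hθ']; push_cast; nlinarith
      have hall : ∀ v ∈ Set.Ici (0 : ℝ),
          0 < coinTail (a * s) (((a * s : ℕ) : ℝ) / 2 + (s * B.mean k - v)) := by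
        intro v hv
        have hv' : (0 : ℝ) ≤ v := hv
        refine lt_of_lt_of_le (by positivity) (two_pow_inv_le_coinTail (a * s) ?_)
        push_cast
        nlinarith
      have hgood := h.sum_measure_estimate_lt_le k hs0 n (θ := θ) (G := Set.Ici 0)
        measurableSet_Ici fun v hv => (hall v hv).trans_le (coinTail_antitone _ (hhalf v))
      have hbad := h.sum_measure_pulls_cumReward_le k s n (S := Set.Iio 0) measurableSet_Iio
      have hnull : sumLaw (B.law k) s (Set.Iio 0) = 0 := by
        refine measure_mono_null (fun v hv => ?_)
          (ae_iff.1 (ae_sumLaw_mem_Icc (B.law k) (B.ae_law_mem_Icc k) s))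
        exact fun hv' => absurd hv (not_lt.2 hv'.1)
      rw [hnull, mul_zero] at hbad
      calc _ ≤ ∑ t ∈ Finset.range n, (P {ω | (pulls I k t ω = s ∧
              cumReward I Y k t ω ∈ Set.Ici (0 : ℝ)) ∧
                ∀ j, estimate a I Y Z j t ω < ((θ / (a + 1) : ℝ) : EReal)} +
            P {ω | pulls I k t ω = s ∧ cumReward I Y k t ω ∈ Set.Iio (0 : ℝ)}) := by
            refine Finset.sum_le_sum fun t _ => (measure_mono ?_).trans (measure_union_le _ _)
            rintro ω ⟨hω, hp⟩
            rcases le_or_gt 0 (cumReward I Y k t ω) with hv | hv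
            · exact Or.inl ⟨⟨hp, hv⟩, hω⟩
            · exact Or.inr ⟨hp, hv⟩
        _ ≤ _ := by
            rw [Finset.sum_add_distrib]
            refine (add_le_add hgood hbad).trans ?_
            rw [add_zero]
            refine le_trans ?_ (lintegral_inv_coinTail_le (B.law k) (B.ae_law_mem_Icc k) ha hs0)
            refine lintegral_mono fun v => ?_
            by_cases hv : v ∈ Set.Ici (0 : ℝ)
            · rw [Set.indicator_of_mem hv]
              refine ENNReal.ofReal_le_ofReal ?_
              have h1 := one_div_le_one_div_of_le (hall v hv) (coinTail_antitone _ (hhalf v))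
              have h2 : ∫ y, y ∂(B.law k) = B.mean k := rfl
              rw [h2]
              linarith
            · rw [Set.indicator_of_notMem hv]
              exact zero_le
    · have hnot : s ∉ Finset.Icc 1 ⌊x⌋₊ := by
        intro hmem
        exact hsx ((Nat.cast_le.2 (Finset.mem_Icc.1 hmem).2).trans (Nat.floor_le hx0.le))
      rw [if_neg hnot, zero_add]
      push Not at hsx
      -- Many pulls: the cumulative reward and the pseudo-rewards both concentrate.
      have hxD : 16 * a * Real.log n ≤ s * D ^ 2 := by
        have := hsx.le
        rwa [hx, div_le_iff₀ (by positivity)] at this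
      set β : ℝ := (B.mean k - D / 4) * s with hβ
      have hq : ∀ v ∈ Set.Ici β, 1 - (1 / (n : ℝ)) ^ 2 ≤ coinTail (a * s) (θ * s - v) := by
        intro v hv
        have hv' : β ≤ v := hv
        have h1 : θ * s - v ≤ ((a * s : ℕ) : ℝ) / 2 - s * D / 4 := by
          rw [hθ']; push_cast; linarith
        have h2 := coinTail_antitone (a * s) h1
        have h3 := one_sub_coinTail_le_exp hm (x := s * D / 4) (by positivity)
        have h4 := exp_neg_le_inv_pow (k := 2) hn0
          (y := 2 * (s * D / 4) ^ 2 / ((a * s : ℕ) : ℝ)) (by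
            rw [le_div_iff₀ hm']
            push_cast
            nlinarith)
        linarith
      have hgood := h.sum_measure_estimate_lt_le k hs0 n (θ := θ) (G := Set.Ici β)
        measurableSet_Ici fun v hv => lt_of_lt_of_le (by linarith) (hq v hv)
      have hbad := h.sum_measure_pulls_cumReward_le k s n (S := Set.Iio β) measurableSet_Iio
      have htail : sumLaw (B.law k) s (Set.Iio β) ≤ ENNReal.ofReal ((1 / (n : ℝ)) ^ 2) := by
        refine (sumLaw_Iio_le k hs0 (by positivity)).trans (ENNReal.ofReal_le_ofReal ?_)
        exact exp_neg_le_inv_pow hn0 (by push_cast; nlinarith)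
      have hbad' : (n : ENNReal) * sumLaw (B.law k) s (Set.Iio β) ≤ ENNReal.ofReal (1 / n) := by
        refine (mul_le_mul_right htail _).trans (le_of_eq ?_)
        rw [← ENNReal.ofReal_natCast, ← ENNReal.ofReal_mul hn'.le]
        congr 1
        field_simp
      have hgood' : ∫⁻ v, (Set.Ici β).indicator (fun v => ENNReal.ofReal
          (1 / coinTail (a * s) (θ * s - v) - 1)) v ∂(sumLaw (B.law k) s) ≤
          ENNReal.ofReal (1 / n) := by
        calc _ ≤ ∫⁻ _, ENNReal.ofReal (1 / n) ∂(sumLaw (B.law k) s) := by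
              refine lintegral_mono fun v => ?_
              by_cases hv : v ∈ Set.Ici β
              · rw [Set.indicator_of_mem hv]
                refine ENNReal.ofReal_le_ofReal ?_
                have h1 := hq v hv
                have h2 := one_div_le_one_div_of_le (by linarith) h1
                have h3 : 1 / (1 - (1 / (n : ℝ)) ^ 2) ≤ 1 + 1 / n := by
                  have hr : 1 / (n : ℝ) ≤ 1 / 2 := one_div_le_one_div_of_le (by norm_num) hn2
                  have hr0 : 0 < 1 / (n : ℝ) := by positivity
                  rw [div_le_iff₀ (by linarith)]
                  nlinarith [mul_nonneg hr0.le (sub_nonneg.2 hr), mul_nonneg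
                    (mul_nonneg hr0.le hr0.le) (sub_nonneg.2 hr)]
                linarith
              · rw [Set.indicator_of_notMem hv]
                exact zero_le
          _ = _ := by simp
      calc _ ≤ ∑ t ∈ Finset.range n, (P {ω | (pulls I k t ω = s ∧
              cumReward I Y k t ω ∈ Set.Ici β) ∧
                ∀ j, estimate a I Y Z j t ω < ((θ / (a + 1) : ℝ) : EReal)} +
            P {ω | pulls I k t ω = s ∧ cumReward I Y k t ω ∈ Set.Iio β}) := by
            refine Finset.sum_le_sum fun t _ => (measure_mono ?_).trans (measure_union_le _ _)
            rintro ω ⟨hω, hp⟩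
            rcases le_or_gt β (cumReward I Y k t ω) with hv | hv
            · exact Or.inl ⟨⟨hp, hv⟩, hω⟩
            · exact Or.inr ⟨hp, hv⟩
        _ ≤ _ := by
            rw [Finset.sum_add_distrib]
            refine (add_le_add (hgood.trans hgood') (hbad.trans hbad')).trans (le_of_eq ?_)
            rw [← ENNReal.ofReal_add (by positivity) (by positivity)]
            congr 1
            ring
  refine (Finset.sum_le_sum hone).trans ?_
  rw [Finset.sum_add_distrib, Finset.sum_const, Finset.card_range, nsmul_eq_mul,
    ← Finset.sum_filter, Finset.sum_const, nsmul_eq_mul]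
  have hcard : (((Finset.range n).filter fun s => s ∈ Finset.Icc 1 ⌊x⌋₊).card : ENNReal) ≤
      ENNReal.ofReal x := by
    have h1 : ((Finset.range n).filter fun s => s ∈ Finset.Icc 1 ⌊x⌋₊).card ≤ ⌊x⌋₊ := by
      refine (Finset.card_le_card (t := Finset.Icc 1 ⌊x⌋₊) fun s hs => ?_).trans (by simp)
      exact (Finset.mem_filter.1 hs).2
    rw [← ENNReal.ofReal_natCast]
    exact ENNReal.ofReal_le_ofReal ((Nat.cast_le.2 h1).trans (Nat.floor_le hx0.le))
  have htwo : (n : ENNReal) * ENNReal.ofReal (2 / n) = ENNReal.ofReal 2 := by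
    rw [← ENNReal.ofReal_natCast, ← ENNReal.ofReal_mul hn'.le, mul_div_cancel₀ _ hn'.ne']
  rw [htwo]
  refine (add_le_add_left (mul_le_mul_left hcard _) _).trans (le_of_eq ?_)
  rw [← ENNReal.ofReal_mul hx0.le, ← ENNReal.ofReal_add (by positivity) (by norm_num), hx]
  congr 1
  ring

end IsRun

/-! ### From pull counts to the regret -/

namespace IsRun

variable [MeasurableSpace Ω] [MeasurableSpace E] {P : Measure Ω} [IsProbabilityMeasure P]
  {B : Bandit K} {a : ℕ} {ξ : Ω → E} {Y : Fin K → ℕ → Ω → ℝ} {Z : Fin K → ℕ → ℕ → Ω → ℝ}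
  {I : ℕ → Ω → Fin K}

lemma integrable_pulls (h : IsRun P B a ξ Y Z I) (i : Fin K) (n : ℕ) :
    Integrable (fun ω => (pulls I i n ω : ℝ)) P :=
  Integrable.of_mem_Icc 0 n (measurable_from_top.comp (h.measurable_pulls i n)).aemeasurable
    (ae_of_all _ fun _ => ⟨Nat.cast_nonneg _, Nat.cast_le.2 (pulls_le n)⟩)

lemma ofReal_integral_pulls (h : IsRun P B a ξ Y Z I) (i : Fin K) (n : ℕ) :
    ENNReal.ofReal (∫ ω, (pulls I i n ω : ℝ) ∂P) = ∑ t ∈ Finset.range n, P {ω | I t ω = i} := by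
  rw [ofReal_integral_eq_lintegral_ofReal (h.integrable_pulls i n)
    (ae_of_all _ fun _ => Nat.cast_nonneg _)]
  have hset : ∀ t, MeasurableSet {ω | I t ω = i} := fun t =>
    h.measurable_arm t (measurableSet_singleton i)
  have h1 : ∀ ω, ENNReal.ofReal (pulls I i n ω : ℝ) =
      ∑ t ∈ Finset.range n, {ω | I t ω = i}.indicator 1 ω := by
    intro ω
    rw [ENNReal.ofReal_natCast, pulls, Nat.cast_sum]
    refine Finset.sum_congr rfl fun t _ => ?_
    by_cases hI : I t ω = i
    · rw [if_pos hI, Set.indicator_of_mem (show ω ∈ {ω | I t ω = i} from hI)]; simp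
    · rw [if_neg hI, Set.indicator_of_notMem (show ω ∉ {ω | I t ω = i} from hI)]; simp
  simp_rw [h1]
  rw [lintegral_finsetSum _ fun t _ => measurable_one.indicator (hset t)]
  exact Finset.sum_congr rfl fun t _ => lintegral_indicator_one (hset t)

lemma sum_integral_pulls (h : IsRun P B a ξ Y Z I) (n : ℕ) :
    ∑ i, ∫ ω, (pulls I i n ω : ℝ) ∂P = n := by
  rw [← integral_finsetSum _ fun i _ => h.integrable_pulls i n]
  have h1 : ∀ ω, ∑ i, (pulls I i n ω : ℝ) = n := by
    intro ω
    rw [← Nat.cast_sum]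
    simp only [pulls]
    rw [Finset.sum_comm]
    simp
  simp [h1]

/-- The gap-dependent bound on the expected number of pulls of a suboptimal arm. -/
lemma integral_pulls_le (h : IsRun P B a ξ Y Z I) (ha : 2 < a) {n : ℕ} (hn : 2 ≤ n) (i : Fin K)
    (hD : 0 < B.gap i) :
    ∫ ω, (pulls I i n ω : ℝ) ∂P ≤
      8 * a * (2 * boundConst a + 1) * Real.log n / B.gap i ^ 2 + 5 := by
  have hlog : 0 ≤ Real.log n := Real.log_natCast_nonneg n
  have ha' : (2 : ℝ) < a := by exact_mod_cast ha
  have hc0 : 0 ≤ boundConst a := by unfold boundConst; positivity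
  refine (ENNReal.ofReal_le_ofReal_iff (by positivity)).1 ?_
  rw [h.ofReal_integral_pulls]
  set τ : EReal := (((B.mean i + B.gap i / 2 + a / 2) / (a + 1) : ℝ) : EReal) with hτ
  calc _ ≤ ∑ t ∈ Finset.range n, (P {ω | I t ω = i ∧ τ ≤ estimate a I Y Z i t ω} +
        P {ω | I t ω = i ∧ estimate a I Y Z i t ω < τ}) := by
        refine Finset.sum_le_sum fun t _ => (measure_mono ?_).trans (measure_union_le _ _)
        intro ω hω
        rcases le_or_gt τ (estimate a I Y Z i t ω) with hle | hlt
        · exact Or.inl ⟨hω, hle⟩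
        · exact Or.inr ⟨hω, hlt⟩
    _ ≤ _ := by
        rw [Finset.sum_add_distrib]
        refine (add_le_add (h.sum_measure_pull_of_le_estimate_le ha hn i hD)
          (h.sum_measure_pull_of_estimate_lt_le ha hn i hD)).trans (le_of_eq ?_)
        rw [← ENNReal.ofReal_add (by positivity) (by positivity)]
        congr 1
        ring

end IsRun

end PHE

theorem theorem3 {K : ℕ} {Ω E : Type*} [MeasurableSpace Ω] [MeasurableSpace E]
    (P : MeasureTheory.Measure Ω) [MeasureTheory.IsProbabilityMeasure P] (B : PHE.Bandit K) (a : ℕ) (ha : 2 < a)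
    (ξ : Ω → E) (Y : Fin K → ℕ → Ω → ℝ) (Z : Fin K → ℕ → ℕ → Ω → ℝ)
    (I : ℕ → Ω → Fin K) (hrun : PHE.IsRun P B a ξ Y Z I) (n : ℕ) :
    PHE.regret P B I n ≤
      4 * √(2 * (a : ℝ) * (2 * PHE.boundConst (a : ℝ) + 1) * (K : ℝ) * (n : ℝ) * Real.log (n : ℝ))
        + 5 * (K : ℝ) := by
  set T : Fin K → ℝ := fun i => ∫ ω, (PHE.pulls I i n ω : ℝ) ∂P with hT
  have hT0 : ∀ i, 0 ≤ T i := fun i => integral_nonneg fun ω => Nat.cast_nonneg _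
  have hTn : ∑ i, T i = n := hrun.sum_integral_pulls n
  have ha' : (2 : ℝ) < a := by exact_mod_cast ha
  have hc0 : 0 ≤ PHE.boundConst a := by unfold PHE.boundConst; positivity
  change ∑ i, B.gap i * T i ≤ _
  rcases Nat.lt_or_ge n 2 with hn | hn
  · -- In at most one round the regret is at most one, and the bound is at least `5 * K`.
    have h1 : ∀ i, B.gap i * T i ≤ 1 := by
      intro i
      have h2 : T i ≤ n := by
        rw [← hTn]
        exact Finset.single_le_sum (fun j _ => hT0 j) (Finset.mem_univ i)
      have h3 : (n : ℝ) ≤ 1 := by exact_mod_cast (by omega : n ≤ 1)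
      exact mul_le_one₀ (B.gap_le_one i) (hT0 i) (h2.trans h3)
    have h2 : ∑ i, B.gap i * T i ≤ K :=
      (Finset.sum_le_sum fun i _ => h1 i).trans (by simp)
    have h3 : 0 ≤ √(2 * (a : ℝ) * (2 * PHE.boundConst (a : ℝ) + 1) * (K : ℝ) * (n : ℝ) *
      Real.log (n : ℝ)) := Real.sqrt_nonneg _
    have h4 : (0 : ℝ) ≤ K := Nat.cast_nonneg _
    linarith
  rcases Nat.eq_zero_or_pos K with rfl | hK
  · simp only [Finset.univ_eq_empty, Finset.sum_empty]
    positivity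
  have hn' : (0 : ℝ) < n := by exact_mod_cast (by omega : 0 < n)
  have hK' : (0 : ℝ) < K := by exact_mod_cast hK
  have hlog : 0 < Real.log n := Real.log_pos (by exact_mod_cast (by omega : 1 < n))
  set L : ℝ := 8 * a * (2 * PHE.boundConst a + 1) * Real.log n with hL
  have hL0 : 0 < L := by positivity
  -- Arms with gap at most `ε` cost at most `ε` per pull; the choice of `ε` balances both sums.
  set R : ℝ := √(K * L * n) with hR
  have hR0 : 0 < R := Real.sqrt_pos.2 (by positivity)
  have hRR : R ^ 2 = K * L * n := Real.sq_sqrt (by positivity)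
  set ε : ℝ := R / n with hε
  have hε0 : 0 < ε := by positivity
  have harm : ∀ i, B.gap i * T i ≤ ε * T i + (L / ε + 5) := by
    intro i
    rcases le_or_gt (B.gap i) ε with hle | hlt
    · have := mul_le_mul_of_nonneg_right hle (hT0 i)
      have : 0 ≤ L / ε := by positivity
      linarith
    · have hD : 0 < B.gap i := hε0.trans hlt
      have h1 : T i ≤ L / B.gap i ^ 2 + 5 := hrun.integral_pulls_le ha hn i hD
      have h2 : B.gap i * T i ≤ L / B.gap i + 5 * B.gap i := by
        refine (mul_le_mul_of_nonneg_left h1 hD.le).trans (le_of_eq ?_)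
        field_simp
      have h3 : L / B.gap i ≤ L / ε := div_le_div_of_nonneg_left hL0.le hε0 hlt.le
      have h4 := B.gap_le_one i
      have h5 : 0 ≤ ε * T i := mul_nonneg hε0.le (hT0 i)
      linarith
  have hsum : ∑ i, B.gap i * T i ≤ ε * n + K * (L / ε + 5) := by
    refine (Finset.sum_le_sum fun i _ => harm i).trans (le_of_eq ?_)
    rw [Finset.sum_add_distrib, ← Finset.mul_sum, hTn, Finset.sum_const,
      Finset.card_univ, Fintype.card_fin, nsmul_eq_mul]
  have h1 : ε * n = R := by rw [hε]; field_simp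
  have h2 : K * (L / ε) = R := by
    rw [hε]
    field_simp
    linarith
  have h3 : 4 * √(2 * (a : ℝ) * (2 * PHE.boundConst (a : ℝ) + 1) * (K : ℝ) * (n : ℝ) *
      Real.log (n : ℝ)) = 2 * R := by
    have h4 : K * L * n = 2 ^ 2 * (2 * (a : ℝ) * (2 * PHE.boundConst (a : ℝ) + 1) * (K : ℝ) *
        (n : ℝ) * Real.log (n : ℝ)) := by rw [hL]; ring
    rw [hR, h4, Real.sqrt_mul (by norm_num) (2 * (a : ℝ) * _ * _ * _ * _),
      Real.sqrt_sq (by norm_num), ← mul_assoc]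
    norm_num
  rw [h3]
  linarith
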